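/- All manifolds and maps are smooth, $\mathbb Z$ is a discrete manifold (so a smooth map to $\mathbb Z$ is a locally constant one), and all line bundles are hermitian complex line bundles with smooth isometric isomorphisms. For a surjective submersion $\pi:Y\to M$ let $Y^{[k]}$ be its $k$-fold fibre product over $M$. A *bundle gerbe* $(P,Y,M)$ is a hermitian line bundle $P\to Y^{[2]}$ with an associative multiplication $P_{(y_1,y_2)}\otimes P_{(y_2,y_3)}\to P_{(y_1,y_3)}$, which is a smooth isomorphism of hermitian line bundles over $Y^{[3]}$. An isomorphism of bundle gerbes with the same $Y\to M$ is an isomorphism of the line bundles over $Y^{[2]}$ that respects the multiplications. The dual $(P,Y,M)^*$ is $P^*$ with the dual multiplication. The product of $(P,Y,M)$ and $(Q,X,M)$ is the bundle gerbe $(P,Y,M)\otimes(Q,X,M)$ with respect to $Y\times_MX\to M$ with fibre $P_{(y_1,y_2)}\otimes Q_{(x_1,x_2)}$, and the reduced product $\otimes_{\mathrm{red}}$ of two bundle gerbes with the same $Y\to M$ has fibre $P_{(y_1,y_2)}\otimes Q_{(y_1,y_2)}$. A line bundle $R\to Y$ defines the bundle gerbe $\delta(R)$ with $\delta(R)_{(y_1,y_2)}=R_{y_2}\otimes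 R_{y_1}^*$ and multiplication given by contraction. $R$ is a *trivialising line bundle* of $(P,Y,M)$ if $(P,Y,M)\cong\delta(R)$; the bundle gerbe is *trivial* if such an $R$ exists; and $(P,Y,M)$, $(Q,X,M)$ are *stably isomorphic* if $(P,Y,M)^*\otimes(Q,X,M)$ is trivial. For a line bundle $K\to N$ put $K^k=K^{\otimes k}$ for $k>0$, $K^k=(K^*)^{\otimes(-k)}$ for $k<0$, and $K^0=\mathbb C$. If $f:Y^{[2]}\to\mathbb Z$ is smooth and $f(y_2,y_3)-f(y_1,y_3)+f(y_1,y_2)=0$ on $Y^{[3]}$, then the *general cup product bundle gerbe* $(K^f,Y\times N,M\times N)$ is the line bundle over $(Y\times N)^{[2]}\cong Y^{[2]}\times N$ with fibre $K_\nu^{f(y_1,y_2)}$ at $(y_1,y_2,\nu)$, with the canonical multiplication $K_\nu^{f(y_1,y_2)}\otimes K_\nu^{f(y_2,y_3)}\to K_\nu^{f(y_1,y_3)}$. **Statement.** Let $X\to M$ and $Y\to M$ be surjective submersions, $N$ a manifold and $m\ge1$. For $i=1,\dots,m$ let $K_i\to N$ be a hermitian line bundle and let $(K_i^{f_i},Y\times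 N,M\times N)$ and $(K_i^{g_i},X\times N,M\times N)$ be general cup product bundle gerbes, with $f_i:Y^{[2]}\to\mathbb Z$ and $g_i:X^{[2]}\to\mathbb Z$ as above. Suppose that for each $i$ there is a smooth $h_i:(X\times_MY)\times N\to\mathbb Z$ with $$f_i(y_1,y_2)-g_i(x_1,x_2)=h_i(x_2,y_2,\nu)-h_i(x_1,y_1,\nu)$$ for all $((x_1,y_1),(x_2,y_2))\in(X\times_MY)^{[2]}$ and $\nu\in N$. Put $F=\bigotimes_{\mathrm{red},\,i}(K_i^{f_i},Y\times N,M\times N)$ and $G=\bigotimes_{\mathrm{red},\,i}(K_i^{g_i},X\times N,M\times N)$. Then 1. $F$ and $G$ are stably isomorphic (that is, $F^*\otimes G$ is trivial); 2. with $\pi_N:(X\times_MY)\times N\to N$ the projection, the line bundle $$\bigotimes_{i=1}^m\pi_N^{*}(K_i)^{h_i}\longrightarrow(X\times_MY)\times N\cong(X\times N)\times_{M\times N}(Y\times N),$$ whose fibre at $(x,y,\nu)$ is $\bigotimes_i(K_i)_\nu^{h_i(x,y,\nu)}$, is a trivialising line bundle of $G^*\otimes F$. -/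

import Mathlib

open scoped Manifold ContDiff Topology TensorProduct InnerProductSpace

universe w

noncomputable section

/-- A surjective submersion between smooth manifolds. -/
structure IsSurjectiveSubmersion {EY HY Y EM HM M : Type*}
    [NormedAddCommGroup EY] [NormedSpace ℝ EY] [TopologicalSpace HY]
    [TopologicalSpace Y] [ChartedSpace HY Y]
    [NormedAddCommGroup EM] [NormedSpace ℝ EM] [TopologicalSpace HM]
    [TopologicalSpace M] [ChartedSpace HM M]
    (IY : ModelWithCorners ℝ EY HY) (IM : ModelWithCorners ℝ EM HM) (π : Y → M) : Prop where
  surjective : Function.Surjective π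
  isSubmersion : Manifold.IsSubmersion IY IM ∞ π

section Manifolds

variable {EM HM M : Type*} [NormedAddCommGroup EM] [NormedSpace ℝ EM] [TopologicalSpace HM]
  [TopologicalSpace M] [ChartedSpace HM M] {IM : ModelWithCorners ℝ EM HM}
  {EX HX X : Type*} [NormedAddCommGroup EX] [NormedSpace ℝ EX] [TopologicalSpace HX]
  [TopologicalSpace X] [ChartedSpace HX X] {IX : ModelWithCorners ℝ EX HX}
  {EY HY Y : Type*} [NormedAddCommGroup EY] [NormedSpace ℝ EY] [TopologicalSpace HY]
  [TopologicalSpace Y] [ChartedSpace HY Y] {IY : ModelWithCorners ℝ EY HY}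
  {EZ HZ Z : Type*} [NormedAddCommGroup EZ] [NormedSpace ℝ EZ] [TopologicalSpace HZ]
  [TopologicalSpace Z] [ChartedSpace HZ Z] {IZ : ModelWithCorners ℝ EZ HZ}
  {EN HN N : Type*} [NormedAddCommGroup EN] [NormedSpace ℝ EN] [TopologicalSpace HN]
  [TopologicalSpace N] [ChartedSpace HN N] {IN : ModelWithCorners ℝ EN HN}
  {πX : X → M} {πY : Y → M}

/-- The fibre product `X ×_M Y` of two surjective submersions. -/
def FibProd (_hX : IsSurjectiveSubmersion IX IM πX) (_hY : IsSurjectiveSubmersion IY IM πY) :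
    Type _ :=
  {p : X × Y // πX p.1 = πY p.2}

/-- A complement of the model space of `M` in the model space of `Y`, on which the fibres of the
surjective submersion `Y → M` are modelled. -/
abbrev IsSurjectiveSubmersion.Fib (hY : IsSurjectiveSubmersion IY IM πY) : Type _ :=
  hY.isSubmersion.complement

theorem IsSurjectiveSubmersion.contMDiff (hX : IsSurjectiveSubmersion IX IM πX) :
    ContMDiff IX IM ∞ πX :=
  hX.isSubmersion.contMDiff

namespace FibProd

variable {hX : IsSurjectiveSubmersion IX IM πX} {hY : IsSurjectiveSubmersion IY IM πY}

/-- The projection `X ×_M Y → X`. -/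
def fst (p : FibProd hX hY) : X := p.1.1

/-- The projection `X ×_M Y → Y`. -/
def snd (p : FibProd hX hY) : Y := p.1.2

theorem comm (p : FibProd hX hY) : πX p.fst = πY p.snd := p.2

/-- The point `(x, y)` of `X ×_M Y`. -/
def mk (hX : IsSurjectiveSubmersion IX IM πX) (hY : IsSurjectiveSubmersion IY IM πY) (x : X) (y : Y) (h : πX x = πY y) : FibProd hX hY := ⟨(x, y), h⟩

@[simp] theorem mk_fst (x : X) (y : Y) (h : πX x = πY y) : (mk hX hY x y h).fst = x := rfl
@[simp] theorem mk_snd (x : X) (y : Y) (h : πX x = πY y) : (mk hX hY x y h).snd = y := rfl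

@[ext] theorem ext {p q : FibProd hX hY} (h1 : p.fst = q.fst) (h2 : p.snd = q.snd) : p = q :=
  Subtype.ext (Prod.ext h1 h2)

instance : TopologicalSpace (FibProd hX hY) :=
  inferInstanceAs (TopologicalSpace {p : X × Y // πX p.1 = πY p.2})

theorem continuous_fst : Continuous (fst : FibProd hX hY → X) :=
  _root_.continuous_fst.comp continuous_subtype_val

theorem continuous_snd : Continuous (snd : FibProd hX hY → Y) :=
  _root_.continuous_snd.comp continuous_subtype_val

/-- A chart of `X` together with a pair of charts of `Y` and `M` in which `Y → M` is a linear
projection. -/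
structure ChartData (_hX : IsSurjectiveSubmersion IX IM πX)
    (hY : IsSurjectiveSubmersion IY IM πY) where
  chX : OpenPartialHomeomorph X HX
  chY : OpenPartialHomeomorph Y HY
  chM : OpenPartialHomeomorph M HM
  chX_mem : chX ∈ IsManifold.maximalAtlas IX ∞ X
  chY_mem : chY ∈ IsManifold.maximalAtlas IY ∞ Y
  chM_mem : chM ∈ IsManifold.maximalAtlas IM ∞ M
  maps : ∀ y ∈ chY.source, πY y ∈ chM.source
  equiv : EY ≃L[ℝ] (EM × hY.Fib)
  eq : ∀ y ∈ chY.source, (equiv (IY (chY y))).1 = IM (chM (πY y))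

namespace ChartData

variable (d : ChartData hX hY)

def toFun (p : FibProd hX hY) : HX × hY.Fib :=
  (d.chX p.fst, (d.equiv (IY (d.chY p.snd))).2)

def invY (q : HX × hY.Fib) : EY :=
  d.equiv.symm (IM (d.chM (πX (d.chX.symm q.1))), q.2)

def source : Set (FibProd hX hY) :=
  {p : FibProd hX hY | p.fst ∈ d.chX.source ∧ p.snd ∈ d.chY.source}

def target : Set (HX × hY.Fib) :=
  {q | (q.1 ∈ d.chX.target ∧ πX (d.chX.symm q.1) ∈ d.chM.source) ∧
    d.invY q ∈ (d.chY.extend IY).target}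

theorem inv_comm {q : HX × hY.Fib} (hq : q ∈ d.target) :
    πX (d.chX.symm q.1) = πY ((d.chY.extend IY).symm (d.invY q)) := by
  obtain ⟨⟨h1, h2⟩, h3⟩ := hq
  have hs : (d.chY.extend IY).symm (d.invY q) ∈ d.chY.source := by
    have := (d.chY.extend IY).map_target h3
    rwa [OpenPartialHomeomorph.extend_source] at this
  have h4 := d.eq _ hs
  have h5 : IY (d.chY ((d.chY.extend IY).symm (d.invY q))) = d.invY q :=
    (d.chY.extend IY).right_inv h3
  rw [h5] at h4
  simp only [invY, ContinuousLinearEquiv.apply_symm_apply] at h4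
  exact d.chM.injOn h2 (d.maps _ hs) (IM.injective h4)

open Classical in
/-- The chart `(x, y) ↦ (φ x, pr₂ (ψ y))` of the fibre product. The point `p₀` only serves as
junk value of the inverse outside the target. -/
def chart [IY.Boundaryless] (p₀ : FibProd hX hY) :
    OpenPartialHomeomorph (FibProd hX hY) (ModelProd HX hY.Fib) where
  toFun := d.toFun
  invFun q := if hq : q ∈ d.target then
    FibProd.mk hX hY (d.chX.symm q.1) ((d.chY.extend IY).symm (d.invY q)) (d.inv_comm hq) else p₀
  source := d.source
  target := d.target
  map_source' := by
    rintro p ⟨h1, h2⟩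
    have h3 : d.invY (d.toFun p) = IY (d.chY p.snd) := by
      simp only [invY, toFun, d.chX.left_inv h1]
      rw [ContinuousLinearEquiv.symm_apply_eq]
      refine Prod.ext ?_ rfl
      rw [d.eq _ h2, p.comm]
    refine ⟨⟨d.chX.map_source h1, ?_⟩, ?_⟩
    · simp only [toFun, d.chX.left_inv h1]
      rw [p.comm]; exact d.maps _ h2
    · rw [h3]
      exact (d.chY.extend IY).map_source (by rwa [OpenPartialHomeomorph.extend_source])
  map_target' := by
    intro q hq
    rw [dif_pos hq]
    refine ⟨d.chX.map_target hq.1.1, ?_⟩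
    have := (d.chY.extend IY).map_target hq.2
    rwa [OpenPartialHomeomorph.extend_source] at this
  left_inv' := by
    rintro p ⟨h1, h2⟩
    have h3 : d.invY (d.toFun p) = IY (d.chY p.snd) := by
      simp only [invY, toFun, d.chX.left_inv h1]
      rw [ContinuousLinearEquiv.symm_apply_eq]
      refine Prod.ext ?_ rfl
      rw [d.eq _ h2, p.comm]
    have h4 : d.toFun p ∈ d.target := by
      refine ⟨⟨d.chX.map_source h1, ?_⟩, ?_⟩
      · simp only [toFun, d.chX.left_inv h1]
        rw [p.comm]; exact d.maps _ h2
      · rw [h3]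
        exact (d.chY.extend IY).map_source (by rwa [OpenPartialHomeomorph.extend_source])
    rw [dif_pos h4]
    refine FibProd.ext ?_ ?_
    · exact d.chX.left_inv h1
    · simp only [mk_snd, h3]
      exact (d.chY.extend IY).left_inv (by rwa [OpenPartialHomeomorph.extend_source])
  right_inv' := by
    intro q hq
    rw [dif_pos hq]
    refine Prod.ext (d.chX.right_inv hq.1.1) ?_
    have h5 : IY (d.chY ((d.chY.extend IY).symm (d.invY q))) = d.invY q :=
      (d.chY.extend IY).right_inv hq.2
    simp only [toFun, mk_snd, h5]
    simp [invY]
  open_source := (d.chX.open_source.preimage continuous_fst).inter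
    (d.chY.open_source.preimage continuous_snd)
  open_target := by
    have hO : IsOpen {q : HX × hY.Fib |
        q.1 ∈ d.chX.target ∧ πX (d.chX.symm q.1) ∈ d.chM.source} := by
      have h := ((hX.contMDiff.continuous.comp_continuousOn d.chX.continuousOn_symm)).isOpen_inter_preimage
        d.chX.open_target d.chM.open_source
      exact h.preimage _root_.continuous_fst
    have hc : ContinuousOn d.invY {q : HX × hY.Fib |
        q.1 ∈ d.chX.target ∧ πX (d.chX.symm q.1) ∈ d.chM.source} := by
      refine d.equiv.symm.continuous.comp_continuousOn (ContinuousOn.prodMk ?_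
        _root_.continuous_snd.continuousOn)
      refine IM.continuous.comp_continuousOn (d.chM.continuousOn.comp
        (hX.contMDiff.continuous.comp_continuousOn (d.chX.continuousOn_symm.comp
          _root_.continuous_fst.continuousOn ?_)) ?_)
      · exact fun q hq => hq.1
      · exact fun q hq => hq.2
    exact hc.isOpen_inter_preimage hO d.chY.isOpen_extend_target
  continuousOn_toFun := by
    refine ContinuousOn.prodMk ?_ ?_
    · exact d.chX.continuousOn.comp continuous_fst.continuousOn fun p hp => hp.1
    · refine (_root_.continuous_snd.comp (d.equiv.continuous.comp
        IY.continuous)).comp_continuousOn ?_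
      exact d.chY.continuousOn.comp continuous_snd.continuousOn fun p hp => hp.2
  continuousOn_invFun := by
    have hc : ContinuousOn d.invY d.target := by
      refine d.equiv.symm.continuous.comp_continuousOn (ContinuousOn.prodMk ?_
        _root_.continuous_snd.continuousOn)
      refine IM.continuous.comp_continuousOn (d.chM.continuousOn.comp
        (hX.contMDiff.continuous.comp_continuousOn (d.chX.continuousOn_symm.comp
          _root_.continuous_fst.continuousOn ?_)) ?_)
      · exact fun q hq => hq.1.1
      · exact fun q hq => hq.1.2
    refine Topology.IsInducing.subtypeVal.continuousOn_iff.2 ?_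
    have : ContinuousOn (fun q => (d.chX.symm q.1, (d.chY.extend IY).symm (d.invY q)))
        d.target := by
      refine ContinuousOn.prodMk (d.chX.continuousOn_symm.comp
          _root_.continuous_fst.continuousOn fun q hq => hq.1.1) ?_
      exact d.chY.continuousOn_extend_symm.comp hc fun q hq => hq.2
    refine this.congr fun q hq => ?_
    simp only [Function.comp, dif_pos hq]
    rfl

theorem chart_symm_apply [IY.Boundaryless] (p₀ : FibProd hX hY) {q : HX × hY.Fib}
    (hq : q ∈ d.target) : (d.chart p₀).symm q = FibProd.mk hX hY (d.chX.symm q.1)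
      ((d.chY.extend IY).symm (d.invY q)) (d.inv_comm hq) :=
  dif_pos hq

theorem contMDiffOn_invY :
    ContMDiffOn (IX.prod 𝓘(ℝ, hY.Fib)) 𝓘(ℝ, EY) ∞ d.invY
      {q : HX × hY.Fib | q.1 ∈ d.chX.target ∧ πX (d.chX.symm q.1) ∈ d.chM.source} := by
  have h1 : ContMDiffOn (IX.prod 𝓘(ℝ, hY.Fib)) IX ∞ (fun q : HX × hY.Fib => d.chX.symm q.1)
      {q : HX × hY.Fib | q.1 ∈ d.chX.target ∧ πX (d.chX.symm q.1) ∈ d.chM.source} :=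
    (contMDiffOn_symm_of_mem_maximalAtlas d.chX_mem).comp contMDiff_fst.contMDiffOn
      fun q hq => hq.1
  have h2 := (d.chM.contMDiffOn_extend d.chM_mem).comp (hX.contMDiff.comp_contMDiffOn h1) fun q hq => hq.2
  have h3 := d.equiv.symm.contDiff.contMDiff.comp_contMDiffOn
    (n := ∞) (h2.prodMk_space contMDiff_snd.contMDiffOn)
  exact h3

theorem contMDiffOn_inv_snd :
    ContMDiffOn (IX.prod 𝓘(ℝ, hY.Fib)) IY ∞
      (fun q : HX × hY.Fib => (d.chY.extend IY).symm (d.invY q)) d.target := by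
  have h1 : ContMDiffOn (IX.prod 𝓘(ℝ, hY.Fib)) 𝓘(ℝ, EY) ∞ d.invY d.target :=
    d.contMDiffOn_invY.mono fun q hq => hq.1
  refine (contMDiffOn_extend_symm d.chY_mem).comp h1 fun q hq => ?_
  rw [← OpenPartialHomeomorph.extend_target']
  exact hq.2

end ChartData

/-- The model of `X ×_M Y`. -/
abbrev _root_.FibProd.model (IX : ModelWithCorners ℝ EX HX)
    (hY : IsSurjectiveSubmersion IY IM πY) :
    ModelWithCorners ℝ (EX × hY.Fib) (ModelProd HX hY.Fib) :=
  IX.prod 𝓘(ℝ, hY.Fib)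

/-- The coordinate change of two charts of `X ×_M Y` is smooth. -/
theorem contMDiffOn_coord (d d' : ChartData hX hY) :
    ContMDiffOn (model IX hY) (model IX hY) ∞
      (fun q : HX × hY.Fib => ((d'.chX (d.chX.symm q.1),
        (d'.equiv (IY (d'.chY ((d.chY.extend IY).symm (d.invY q))))).2) : HX × hY.Fib))
      {q : HX × hY.Fib | q ∈ d.target ∧ d.chX.symm q.1 ∈ d'.chX.source ∧
        (d.chY.extend IY).symm (d.invY q) ∈ d'.chY.source} := by
  have h1 : ContMDiffOn (model IX hY) IX ∞ (fun q : HX × hY.Fib => d'.chX (d.chX.symm q.1))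
      {q : HX × hY.Fib | q ∈ d.target ∧ d.chX.symm q.1 ∈ d'.chX.source ∧
        (d.chY.extend IY).symm (d.invY q) ∈ d'.chY.source} :=
    (contMDiffOn_of_mem_maximalAtlas d'.chX_mem).comp
      ((contMDiffOn_symm_of_mem_maximalAtlas d.chX_mem).comp contMDiff_fst.contMDiffOn
        fun q hq => hq.1.1.1) fun q hq => hq.2.1
  have h2 := (d'.chY.contMDiffOn_extend d'.chY_mem).comp
    (d.contMDiffOn_inv_snd.mono fun q (hq : q ∈ {q : HX × hY.Fib | q ∈ d.target ∧
      d.chX.symm q.1 ∈ d'.chX.source ∧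
        (d.chY.extend IY).symm (d.invY q) ∈ d'.chY.source}) => hq.1)
    (fun q hq => hq.2.2)
  exact h1.prodMk ((contDiff_snd.comp d'.equiv.contDiff).contMDiff.comp_contMDiffOn (n := ∞) h2)

section

variable [IY.Boundaryless] [IsManifold IX ∞ X]

/-- Charts of `X ×_M Y` around a given point. -/
def chartDataAt (p : FibProd hX hY) : ChartData hX hY where
  chX := chartAt HX p.fst
  chY := (hY.isSubmersion.isSubmersionOfComplement_complement p.snd).domChart
  chM := (hY.isSubmersion.isSubmersionOfComplement_complement p.snd).codChart
  chX_mem := IsManifold.chart_mem_maximalAtlas _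
  chY_mem := Manifold.IsSubmersionAtOfComplement.domChart_mem_maximalAtlas _
  chM_mem := Manifold.IsSubmersionAtOfComplement.codChart_mem_maximalAtlas _
  maps := Manifold.IsSubmersionAtOfComplement.mapsto_domChart_source_codChart_source _
  equiv := (hY.isSubmersion.isSubmersionOfComplement_complement p.snd).equiv
  eq y hy := by
    set h := hY.isSubmersion.isSubmersionOfComplement_complement p.snd
    have h1 := h.writtenInCharts ((h.domChart.extend IY).map_source
      (by rwa [OpenPartialHomeomorph.extend_source]))
    have h2 : (h.domChart.extend IY).symm ((h.domChart.extend IY) y) = y :=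
      (h.domChart.extend IY).left_inv (by rwa [OpenPartialHomeomorph.extend_source])
    simp only [Function.comp, h2] at h1
    exact h1.symm

instance : ChartedSpace (ModelProd HX hY.Fib) (FibProd hX hY) where
  atlas := {e | ∃ (d : ChartData hX hY) (p₀ : FibProd hX hY),
    e = d.chart p₀}
  chartAt p := (chartDataAt p).chart p
  mem_chart_source p := ⟨mem_chart_source _ _,
    Manifold.IsSubmersionAtOfComplement.mem_domChart_source _⟩
  chart_mem_atlas p := ⟨_, _, rfl⟩

instance : IsManifold (model IX hY) ∞ (FibProd hX hY) := by
  apply isManifold_of_contDiffOn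
  rintro e e' ⟨d, p₀, rfl⟩ ⟨d', p₀', rfl⟩
  have h := contMDiffOn_coord d d'
  have hI : ContMDiff (model IX hY) 𝓘(ℝ, EX × hY.Fib) ∞ (M := HX × hY.Fib) (model IX hY) := by
    rw [chartedSpaceSelf_prod]; exact (model IX hY).contMDiff
  have hI' : ContMDiffOn 𝓘(ℝ, EX × hY.Fib) (model IX hY) ∞ (M' := HX × hY.Fib)
      (model IX hY).symm (Set.range (model IX hY)) := by
    rw [chartedSpaceSelf_prod]; exact (model IX hY).contMDiffOn_symm
  set S := (model IX hY).symm ⁻¹' ((d.chart p₀).symm.trans (d'.chart p₀')).source ∩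
    Set.range (model IX hY)
  have hm : Set.MapsTo (model IX hY).symm S {q : HX × hY.Fib | q ∈ d.target ∧
      d.chX.symm q.1 ∈ d'.chX.source ∧ (d.chY.extend IY).symm (d.invY q) ∈ d'.chY.source} := by
    rintro v ⟨⟨h1, h2⟩, -⟩
    change (d.chart p₀).symm _ ∈ (d'.chart p₀').source at h2
    rw [d.chart_symm_apply p₀ h1] at h2
    exact ⟨h1, h2⟩
  have h2 := hI.comp_contMDiffOn (h.comp (hI'.mono (Set.inter_subset_right : S ⊆ _)) hm)
  refine h2.contDiffOn.congr fun v hv => ?_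
  have h3 := d.chart_symm_apply p₀ (hm hv).1
  simp only [Function.comp, OpenPartialHomeomorph.coe_trans, h3]
  rfl

theorem chart_mem_maximalAtlas (d : ChartData hX hY) (p₀ : FibProd hX hY) :
    d.chart p₀ ∈ IsManifold.maximalAtlas (model IX hY) ∞ (FibProd hX hY) :=
  IsManifold.subset_maximalAtlas ⟨d, p₀, rfl⟩

theorem contMDiffAt_chart (d : ChartData hX hY) (p₀ : FibProd hX hY) {p : FibProd hX hY}
    (hp : p ∈ (d.chart p₀).source) :
    ContMDiffAt (model IX hY) (model IX hY) ∞ (M' := HX × hY.Fib) (d.chart p₀) p := by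
  rw [chartedSpaceSelf_prod]
  exact contMDiffAt_of_mem_maximalAtlas (chart_mem_maximalAtlas d p₀) hp

theorem contMDiff_fst : ContMDiff (model IX hY) IX ∞ (fst : FibProd hX hY → X) := by
  intro p
  set d := chartDataAt p
  have hp : p ∈ (d.chart p).source := mem_chart_source _ p
  have h1 := contMDiffAt_chart d p hp
  have h2 : ContMDiffAt (model IX hY) IX ∞ (fun q => d.chX.symm ((d.chart p) q).1) p :=
    (contMDiffAt_symm_of_mem_maximalAtlas d.chX_mem (d.chX.map_source hp.1)).comp p
      (_root_.contMDiff_fst.contMDiffAt.comp p h1)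
  refine h2.congr_of_eventuallyEq ?_
  filter_upwards [(d.chart p).open_source.mem_nhds hp] with q hq
  exact (d.chX.left_inv hq.1).symm

theorem contMDiff_snd : ContMDiff (model IX hY) IY ∞ (snd : FibProd hX hY → Y) := by
  intro p
  set d := chartDataAt p
  have hp : p ∈ (d.chart p).source := mem_chart_source _ p
  have h1 := contMDiffAt_chart d p hp
  have h2 : ContMDiffAt (model IX hY) IY ∞
      (fun q => (d.chY.extend IY).symm (d.invY ((d.chart p) q))) p := by
    have h3 : d.chart p p ∈ d.target := (d.chart p).map_source hp
    exact (d.contMDiffOn_inv_snd.contMDiffAt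
      ((d.chart p).open_target.mem_nhds h3)).comp p h1
  refine h2.congr_of_eventuallyEq ?_
  filter_upwards [(d.chart p).open_source.mem_nhds hp] with q hq
  have h4 := d.chart_symm_apply p ((d.chart p).map_source hq)
  rw [(d.chart p).left_inv hq] at h4
  exact congrArg snd h4

/-- A map into the fibre product is smooth if its components are. -/
theorem contMDiff_mk {a : Z → X} {b : Z → Y} (ha : ContMDiff IZ IX ∞ a) (hb : ContMDiff IZ IY ∞ b)
    (h : ∀ z, πX (a z) = πY (b z)) :
    ContMDiff IZ (model IX hY) ∞ (fun z => mk hX hY (a z) (b z) (h z)) := by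
  intro z
  set p : FibProd hX hY := mk hX hY (a z) (b z) (h z)
  set d := chartDataAt p
  have hp : p ∈ (d.chart p).source := mem_chart_source _ p
  have h0 : ContinuousAt (fun z => mk hX hY (a z) (b z) (h z)) z :=
    ((ha.continuous.prodMk hb.continuous).subtype_mk _).continuousAt
  have h1 : ContMDiffAt IZ (model IX hY) ∞ (fun z => d.toFun (mk hX hY (a z) (b z) (h z))) z := by
    refine ((contMDiffAt_of_mem_maximalAtlas d.chX_mem hp.1).comp z (ha z)).prodMk ?_
    exact ((contDiff_snd.comp d.equiv.contDiff).contMDiff.contMDiffAt (n := ∞)).comp z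
      ((d.chY.contMDiffAt_extend d.chY_mem hp.2).comp z (hb z))
  have h1' : ContMDiffAt IZ (model IX hY) ∞ (M' := ModelProd HX hY.Fib)
      (fun z => d.toFun (mk hX hY (a z) (b z) (h z))) z := by
    rw [chartedSpaceSelf_prod] at h1
    exact h1
  have h2 := (contMDiffAt_symm_of_mem_maximalAtlas (chart_mem_maximalAtlas d p)
    ((d.chart p).map_source hp)).comp z h1'
  refine h2.congr_of_eventuallyEq ?_
  filter_upwards [h0.preimage_mem_nhds ((d.chart p).open_source.mem_nhds hp)] with z' hz'
  exact ((d.chart p).left_inv hz').symm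

end
end FibProd

/-- The fibre product of two surjective submersions over `M` is a surjective submersion. -/
theorem IsSurjectiveSubmersion.fibProd [IY.Boundaryless] [IsManifold IX ∞ X]
    (hX : IsSurjectiveSubmersion IX IM πX) (hY : IsSurjectiveSubmersion IY IM πY) :
    IsSurjectiveSubmersion (FibProd.model IX hY) IM (fun p : FibProd hX hY => πX p.fst) where
  surjective m := by
    obtain ⟨x, rfl⟩ := hX.surjective m
    obtain ⟨y, hy⟩ := hY.surjective (πX x)
    exact ⟨FibProd.mk hX hY x y hy.symm, rfl⟩
  isSubmersion := by
    refine Manifold.IsSubmersionOfComplement.isSubmersion (F := hX.Fib × hY.Fib) fun p => ?_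
    set h := hX.isSubmersion.isSubmersionOfComplement_complement p.fst
    set d : FibProd.ChartData hX hY :=
      { FibProd.chartDataAt p with
        chX := h.domChart
        chX_mem := h.domChart_mem_maximalAtlas }
    refine Manifold.IsSubmersionAtOfComplement.mk_of_charts
      (((h.equiv.prodCongr (ContinuousLinearEquiv.refl ℝ hY.Fib)).trans
        (ContinuousLinearEquiv.prodAssoc ℝ EM hX.Fib hY.Fib))) (d.chart p) h.codChart
      ⟨h.mem_domChart_source, Manifold.IsSubmersionAtOfComplement.mem_domChart_source _⟩
      h.mem_codChart_source (FibProd.chart_mem_maximalAtlas d p) h.codChart_mem_maximalAtlas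
      (fun q hq => h.mapsto_domChart_source_codChart_source hq.1) ?_
    intro v hv
    rw [OpenPartialHomeomorph.extend_target] at hv
    obtain ⟨h1, h2⟩ := hv
    have h1' : ((IX.symm v.1, v.2) : HX × hY.Fib) ∈ d.target := h1
    have h2' : v.1 ∈ Set.range IX := by
      obtain ⟨u, rfl⟩ := h2
      exact ⟨u.1, rfl⟩
    have h3 : v.1 ∈ (h.domChart.extend IX).target := by
      rw [OpenPartialHomeomorph.extend_target]
      exact ⟨h1'.1.1, h2'⟩
    have h4 := h.writtenInCharts h3
    have h5 := d.chart_symm_apply p h1'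
    have h6 : ((d.chart p).extend (FibProd.model IX hY)).symm v =
      (d.chart p).symm (IX.symm v.1, v.2) := rfl
    simp only [Function.comp, h6, h5]
    exact h4

/-- `Y × N → M × N` is a surjective submersion if `Y → M` is. -/
theorem IsSurjectiveSubmersion.prodId [IsManifold IY ∞ Y] [IsManifold IM ∞ M] [IsManifold IN ∞ N]
    (hY : IsSurjectiveSubmersion IY IM πY) :
    IsSurjectiveSubmersion (IY.prod IN) (IM.prod IN) (Prod.map πY (id : N → N)) where
  surjective := hY.surjective.prodMap Function.surjective_id
  isSubmersion := hY.isSubmersion.prodMap Manifold.IsSubmersion.id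

end Manifolds

/-- A hermitian line: a one-dimensional complex inner product space. -/
structure HermLine : Type (w + 1) where
  carrier : Type w
  [group : NormedAddCommGroup carrier]
  [inner : InnerProductSpace ℂ carrier]
  finrank_eq_one : Module.finrank ℂ carrier = 1

namespace HermLine

instance : CoeSort HermLine.{w} (Type w) := ⟨carrier⟩

instance (L : HermLine.{w}) : NormedAddCommGroup L := L.group

instance (L : HermLine.{w}) : InnerProductSpace ℂ L := L.inner

instance (L : HermLine.{w}) : FiniteDimensional ℂ L :=
  FiniteDimensional.of_finrank_pos (by rw [L.finrank_eq_one]; exact one_pos)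

instance (L : HermLine.{w}) : CompleteSpace L := FiniteDimensional.complete ℂ L

theorem eq_inner_smul {L : HermLine.{w}} {u : L} (hu : ‖u‖ = 1) (x : L) : x = ⟪u, x⟫_ℂ • u := by
  have hne : u ≠ 0 := by rintro rfl; simp at hu
  obtain ⟨c, rfl⟩ := (finrank_eq_one_iff_of_nonzero' u hne).1 L.finrank_eq_one x
  rw [inner_smul_right, inner_self_eq_norm_sq_to_K, hu]
  simp

theorem exists_unit (L : HermLine.{w}) : ∃ u : L, ‖u‖ = 1 := by
  have : Nontrivial L := Module.nontrivial_of_finrank_pos (R := ℂ)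
    (by rw [L.finrank_eq_one]; exact one_pos)
  obtain ⟨v, hv⟩ := exists_ne (0 : L)
  exact ⟨((‖v‖ : ℂ)⁻¹) • v, norm_smul_inv_norm hv⟩

/-- The isometry of hermitian lines that takes a given unit vector to a given unit vector. -/
def isoOfUnit {L L' : HermLine.{w}} (u : L) (hu : ‖u‖ = 1) (v : L') (hv : ‖v‖ = 1) :
    L ≃ₗᵢ[ℂ] L' where
  toFun x := ⟪u, x⟫_ℂ • v
  invFun y := ⟪v, y⟫_ℂ • u
  map_add' x y := by rw [inner_add_right, add_smul]
  map_smul' c x := by simp [mul_smul]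
  left_inv x := by
    simp only [inner_smul_right, inner_self_eq_norm_sq_to_K, hv]
    simpa using (eq_inner_smul hu x).symm
  right_inv y := by
    simp only [inner_smul_right, inner_self_eq_norm_sq_to_K, hu]
    simpa using (eq_inner_smul hv y).symm
  norm_map' x := by
    change ‖⟪u, x⟫_ℂ • v‖ = ‖x‖
    conv_rhs => rw [eq_inner_smul hu x]
    rw [norm_smul, norm_smul, hu, hv]

@[simp] theorem isoOfUnit_apply {L L' : HermLine.{w}} (u : L) (hu : ‖u‖ = 1) (v : L')
    (hv : ‖v‖ = 1) (x : L) : isoOfUnit u hu v hv x = ⟪u, x⟫_ℂ • v := rfl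

theorem isoOfUnit_unit {L L' : HermLine.{w}} (u : L) (hu : ‖u‖ = 1) (v : L')
    (hv : ‖v‖ = 1) : isoOfUnit u hu v hv u = v := by
  simp [inner_self_eq_norm_sq_to_K, hu]

/-- The trivial line `ℂ`. -/
def unit : HermLine.{w} :=
  letI : Inner ℂ (ULift.{w} ℂ) := ⟨fun x y => ⟪x.down, y.down⟫_ℂ⟩
  letI : InnerProductSpace ℂ (ULift.{w} ℂ) :=
    { norm_sq_eq_re_inner := fun x => norm_sq_eq_re_inner (𝕜 := ℂ) x.down
      conj_inner_symm := fun x y => inner_conj_symm x.down y.down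
      add_left := fun x y z => inner_add_left x.down y.down z.down
      smul_left := fun x y r => inner_smul_left x.down y.down r }
  { carrier := ULift.{w} ℂ
    finrank_eq_one := by
      rw [(ULift.moduleEquiv (R := ℂ) (M := ℂ)).finrank_eq, Module.finrank_self] }

/-- `1 ∈ ℂ`. -/
def unitOne : unit.{w} := ULift.up (1 : ℂ)

theorem inner_unitOne : ⟪unitOne.{w}, unitOne.{w}⟫_ℂ = 1 := by
  change ⟪(1 : ℂ), (1 : ℂ)⟫_ℂ = 1
  simp

/-- The tensor product of hermitian lines. -/
def tensor (L L' : HermLine.{w}) : HermLine.{w} where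
  carrier := L ⊗[ℂ] L'
  finrank_eq_one := by
    rw [Module.finrank_tensorProduct, L.finrank_eq_one, L'.finrank_eq_one]

/-- The tensor product of two vectors. -/
def tmul {L L' : HermLine.{w}} (x : L) (y : L') : L.tensor L' := x ⊗ₜ[ℂ] y

@[simp] theorem inner_tmul {L L' : HermLine.{w}} (x x' : L) (y y' : L') :
    ⟪tmul x y, tmul x' y'⟫_ℂ = ⟪x, x'⟫_ℂ * ⟪y, y'⟫_ℂ := TensorProduct.inner_tmul ℂ x x' y y'

@[simp] theorem norm_tmul {L L' : HermLine.{w}} (x : L) (y : L') :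
    ‖tmul x y‖ = ‖x‖ * ‖y‖ := TensorProduct.norm_tmul x y

/-- The dual of a hermitian line, with the dual hermitian metric. -/
def dual (L : HermLine.{w}) : HermLine.{w} :=
  letI : Inner ℂ (StrongDual ℂ L) :=
    ⟨fun φ ψ => ⟪(InnerProductSpace.toDual ℂ L).symm ψ, (InnerProductSpace.toDual ℂ L).symm φ⟫_ℂ⟩
  letI : InnerProductSpace ℂ (StrongDual ℂ L) :=
    { norm_sq_eq_re_inner := fun φ => by
        rw [← (InnerProductSpace.toDual ℂ L).symm.norm_map φ]
        exact norm_sq_eq_re_inner (𝕜 := ℂ) _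
      conj_inner_symm := fun φ ψ => inner_conj_symm _ _
      add_left := fun φ ψ χ => by
        change ⟪(InnerProductSpace.toDual ℂ L).symm χ,
          (InnerProductSpace.toDual ℂ L).symm (φ + ψ)⟫_ℂ =
          ⟪(InnerProductSpace.toDual ℂ L).symm χ, (InnerProductSpace.toDual ℂ L).symm φ⟫_ℂ +
          ⟪(InnerProductSpace.toDual ℂ L).symm χ, (InnerProductSpace.toDual ℂ L).symm ψ⟫_ℂ
        rw [map_add, inner_add_right]
      smul_left := fun φ ψ r => by
        change ⟪(InnerProductSpace.toDual ℂ L).symm ψ,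
          (InnerProductSpace.toDual ℂ L).symm (r • φ)⟫_ℂ = (starRingEnd ℂ) r *
          ⟪(InnerProductSpace.toDual ℂ L).symm ψ, (InnerProductSpace.toDual ℂ L).symm φ⟫_ℂ
        rw [map_smulₛₗ, inner_smul_right] }
  { carrier := StrongDual ℂ L
    finrank_eq_one := by
      rw [← (LinearMap.toContinuousLinearMap (𝕜 := ℂ) (E := L) (F' := ℂ)).finrank_eq]
      exact (Subspace.dual_finrank_eq (K := ℂ) (V := L)).trans L.finrank_eq_one }

/-- Evaluation of an element of the dual line. -/
def eval {L : HermLine.{w}} (φ : L.dual) (x : L) : ℂ := (show StrongDual ℂ L from φ) x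

/-- The element `⟪x, ·⟫` of the dual line; for a unit vector `x` it is the dual basis vector. -/
def covec {L : HermLine.{w}} (x : L) : L.dual := InnerProductSpace.toDual ℂ L x

@[simp] theorem eval_covec {L : HermLine.{w}} (x y : L) : eval (covec x) y = ⟪x, y⟫_ℂ := rfl

@[simp] theorem inner_covec {L : HermLine.{w}} (x y : L) : ⟪covec x, covec y⟫_ℂ = ⟪y, x⟫_ℂ := by
  change ⟪(InnerProductSpace.toDual ℂ L).symm (InnerProductSpace.toDual ℂ L y),
    (InnerProductSpace.toDual ℂ L).symm (InnerProductSpace.toDual ℂ L x)⟫_ℂ = _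
  simp

@[simp] theorem norm_covec {L : HermLine.{w}} (x : L) : ‖covec x‖ = ‖x‖ :=
  (InnerProductSpace.toDual ℂ L).norm_map x

/-- The tensor power `L ⊗ ⋯ ⊗ L` of a line. -/
def npow (L : HermLine.{w}) : ℕ → HermLine.{w}
  | 0 => unit
  | 1 => L
  | k + 2 => (npow L (k + 1)).tensor L

/-- The vector `x ⊗ ⋯ ⊗ x`. -/
def npowVec {L : HermLine.{w}} (x : L) : (k : ℕ) → L.npow k
  | 0 => unitOne
  | 1 => x
  | k + 2 => tmul (npowVec x (k + 1)) x

theorem inner_npowVec {L : HermLine.{w}} (x y : L) :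
    ∀ k : ℕ, ⟪npowVec x k, npowVec y k⟫_ℂ = ⟪x, y⟫_ℂ ^ k
  | 0 => by rw [pow_zero]; exact inner_unitOne.{w}
  | 1 => by rw [pow_one]; rfl
  | k + 2 => by
    rw [pow_succ, ← inner_npowVec x y (k + 1)]
    exact inner_tmul _ _ _ _

/-- The power `L^k`, `k ∈ ℤ`: a tensor power of `L` for `k > 0`, of the dual line for `k < 0`, and
`ℂ` for `k = 0`. -/
def zpow (L : HermLine.{w}) : ℤ → HermLine.{w}
  | Int.ofNat k => L.npow k
  | Int.negSucc k => L.dual.npow (k + 1)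

/-- The vector `x^k ∈ L^k`: it is `x ⊗ ⋯ ⊗ x` for `k > 0`, and `x* ⊗ ⋯ ⊗ x*` for `k < 0`. -/
def zpowVec {L : HermLine.{w}} (x : L) : (k : ℤ) → L.zpow k
  | Int.ofNat k => npowVec x k
  | Int.negSucc k => npowVec (covec x) (k + 1)


theorem norm_npowVec {L : HermLine.{w}} {x : L} (hx : ‖x‖ = 1) (k : ℕ) : ‖npowVec x k‖ = 1 := by
  have h := inner_npowVec x x k
  rw [inner_self_eq_norm_sq_to_K, inner_self_eq_norm_sq_to_K, hx] at h
  have h2 : ‖npowVec x k‖ ^ 2 = 1 := by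
    have h3 : ((‖npowVec x k‖ ^ 2 : ℝ) : ℂ) = ((1 : ℝ) : ℂ) := by
      simpa using h
    exact Complex.ofReal_injective h3
  nlinarith [norm_nonneg (npowVec x k)]

theorem norm_zpowVec {L : HermLine.{w}} {x : L} (hx : ‖x‖ = 1) : ∀ k : ℤ, ‖zpowVec x k‖ = 1
  | Int.ofNat k => norm_npowVec hx k
  | Int.negSucc k => norm_npowVec (by rw [norm_covec, hx]) (k + 1)

theorem norm_inner_unit {L : HermLine.{w}} {x y : L} (hx : ‖x‖ = 1) (hy : ‖y‖ = 1) :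
    ‖⟪x, y⟫_ℂ‖ = 1 := by
  have h := congrArg norm (eq_inner_smul hx y)
  rw [norm_smul, hx, hy, mul_one] at h
  exact h.symm

theorem inner_unit_inv {L : HermLine.{w}} {x y : L} (hx : ‖x‖ = 1) (hy : ‖y‖ = 1) :
    ⟪y, x⟫_ℂ = (⟪x, y⟫_ℂ)⁻¹ := by
  rw [Complex.inv_def, Complex.normSq_eq_norm_sq, norm_inner_unit hx hy, inner_conj_symm]
  simp

theorem inner_zpowVec {L : HermLine.{w}} {x y : L} (hx : ‖x‖ = 1) (hy : ‖y‖ = 1) :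
    ∀ k : ℤ, ⟪zpowVec x k, zpowVec y k⟫_ℂ = ⟪x, y⟫_ℂ ^ k
  | Int.ofNat k => by
    rw [Int.ofNat_eq_natCast, zpow_natCast]
    exact inner_npowVec x y k
  | Int.negSucc k => by
    rw [zpow_negSucc, ← inv_pow, ← inner_unit_inv hx hy, ← inner_covec x y]
    exact inner_npowVec (covec x) (covec y) (k + 1)

theorem zpowVec_eq {L : HermLine.{w}} {x y : L} (hx : ‖x‖ = 1) (hy : ‖y‖ = 1) (k : ℤ) :
    zpowVec y k = ⟪x, y⟫_ℂ ^ k • zpowVec x k := by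
  rw [← inner_zpowVec hx hy]
  exact eq_inner_smul (norm_zpowVec hx k) _

/-- The tensor product `A ⊗ A' ⊗ (B ⊗ B') → C ⊗ C'` of two multiplications `A ⊗ B → C` and
`A' ⊗ B' → C'`. -/
def tensorMul {A B C A' B' C' : HermLine.{w}} (m : A.tensor B ≃ₗᵢ[ℂ] C)
    (m' : A'.tensor B' ≃ₗᵢ[ℂ] C') :
    (A.tensor A').tensor (B.tensor B') ≃ₗᵢ[ℂ] C.tensor C' :=
  isoOfUnit
    (tmul (tmul A.exists_unit.choose A'.exists_unit.choose)
      (tmul B.exists_unit.choose B'.exists_unit.choose))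
    (by simp [A.exists_unit.choose_spec, B.exists_unit.choose_spec, A'.exists_unit.choose_spec,
      B'.exists_unit.choose_spec])
    (tmul (m (tmul A.exists_unit.choose B.exists_unit.choose))
      (m' (tmul A'.exists_unit.choose B'.exists_unit.choose)))
    (by simp [A.exists_unit.choose_spec, B.exists_unit.choose_spec, A'.exists_unit.choose_spec,
      B'.exists_unit.choose_spec])

theorem smul_tmul_smul {L L' : HermLine.{w}} (c c' : ℂ) (x : L) (y : L') :
    tmul (c • x) (c' • y) = (c * c') • tmul x y :=
  TensorProduct.smul_tmul_smul c c' x y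

theorem tensorMul_tmul {A B C A' B' C' : HermLine.{w}} (m : A.tensor B ≃ₗᵢ[ℂ] C)
    (m' : A'.tensor B' ≃ₗᵢ[ℂ] C') (a : A) (b : B) (a' : A') (b' : B') :
    tensorMul m m' (tmul (tmul a a') (tmul b b')) = tmul (m (tmul a b)) (m' (tmul a' b')) := by
  conv_rhs => rw [eq_inner_smul A.exists_unit.choose_spec a,
    eq_inner_smul B.exists_unit.choose_spec b, eq_inner_smul A'.exists_unit.choose_spec a',
    eq_inner_smul B'.exists_unit.choose_spec b', smul_tmul_smul, smul_tmul_smul, map_smul, map_smul,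
    smul_tmul_smul]
  simp only [tensorMul, isoOfUnit_apply, inner_tmul]
  congr 1
  ring

/-- The multiplication `A* ⊗ B* → C*` dual to a multiplication `A ⊗ B → C`. -/
def dualMul {A B C : HermLine.{w}} (m : A.tensor B ≃ₗᵢ[ℂ] C) :
    A.dual.tensor B.dual ≃ₗᵢ[ℂ] C.dual :=
  isoOfUnit (tmul (covec A.exists_unit.choose) (covec B.exists_unit.choose))
    (by simp [A.exists_unit.choose_spec, B.exists_unit.choose_spec])
    (covec (m (tmul A.exists_unit.choose B.exists_unit.choose)))
    (by simp [A.exists_unit.choose_spec, B.exists_unit.choose_spec])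

theorem covec_smul {L : HermLine.{w}} (c : ℂ) (x : L) :
    covec (c • x) = (starRingEnd ℂ) c • covec x :=
  (InnerProductSpace.toDual ℂ L).map_smulₛₗ c x

theorem dualMul_covec {A B C : HermLine.{w}} (m : A.tensor B ≃ₗᵢ[ℂ] C) (a : A) (b : B) :
    dualMul m (tmul (covec a) (covec b)) = covec (m (tmul a b)) := by
  conv_rhs => rw [eq_inner_smul A.exists_unit.choose_spec a,
    eq_inner_smul B.exists_unit.choose_spec b, smul_tmul_smul, map_smul, covec_smul, map_mul,
    inner_conj_symm, inner_conj_symm]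
  simp only [dualMul, isoOfUnit_apply, inner_tmul, inner_covec]

theorem exists_covec {L : HermLine.{w}} (φ : L.dual) : ∃ x : L, φ = covec x :=
  ⟨(InnerProductSpace.toDual ℂ L).symm φ, ((InnerProductSpace.toDual ℂ L).apply_symm_apply φ).symm⟩

/-- The dual multiplication is `α ⊗ β ↦ (m (a ⊗ b) ↦ α a * β b)`. -/
theorem eval_dualMul {A B C : HermLine.{w}} (m : A.tensor B ≃ₗᵢ[ℂ] C) (α : A.dual) (β : B.dual)
    (a : A) (b : B) : eval (dualMul m (tmul α β)) (m (tmul a b)) = eval α a * eval β b := by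
  obtain ⟨x, rfl⟩ := exists_covec α
  obtain ⟨y, rfl⟩ := exists_covec β
  rw [dualMul_covec, eval_covec, eval_covec, eval_covec, LinearIsometryEquiv.inner_map_map,
    inner_tmul]

/-- The contraction `(R₂ ⊗ R₁*) ⊗ (R₃ ⊗ R₂*) → R₃ ⊗ R₁*`. -/
def contract (R₁ R₂ R₃ : HermLine.{w}) :
    (R₂.tensor R₁.dual).tensor (R₃.tensor R₂.dual) ≃ₗᵢ[ℂ] R₃.tensor R₁.dual :=
  isoOfUnit
    (tmul (tmul R₂.exists_unit.choose (covec R₁.exists_unit.choose))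
      (tmul R₃.exists_unit.choose (covec R₂.exists_unit.choose)))
    (by simp [R₁.exists_unit.choose_spec, R₂.exists_unit.choose_spec, R₃.exists_unit.choose_spec])
    (tmul R₃.exists_unit.choose (covec R₁.exists_unit.choose))
    (by simp [R₁.exists_unit.choose_spec, R₃.exists_unit.choose_spec])

/-- The contraction is `(a ⊗ α) ⊗ (b ⊗ β) ↦ β a • (b ⊗ α)`. -/
theorem contract_tmul {R₁ R₂ R₃ : HermLine.{w}} (a : R₂) (α : R₁.dual) (b : R₃) (β : R₂.dual) :
    contract R₁ R₂ R₃ (tmul (tmul a α) (tmul b β)) = eval β a • tmul b α := by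
  obtain ⟨x, rfl⟩ := exists_covec α
  obtain ⟨y, rfl⟩ := exists_covec β
  have hb := eq_inner_smul R₃.exists_unit.choose_spec b
  have hx := eq_inner_smul R₁.exists_unit.choose_spec x
  have hy : ⟪y, a⟫_ℂ = ⟪R₂.exists_unit.choose, a⟫_ℂ * ⟪y, R₂.exists_unit.choose⟫_ℂ := by
    conv_lhs => rw [eq_inner_smul R₂.exists_unit.choose_spec a, inner_smul_right]
  conv_rhs => rw [hb, hx, covec_smul, inner_conj_symm, smul_tmul_smul, smul_smul, eval_covec, hy]
  simp only [contract, isoOfUnit_apply, inner_tmul, inner_covec]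
  congr 1
  ring

/-- The multiplication `L^a ⊗ L'^b → L^(a+b)`, where the lines `L` and `L'` are identified
through `e`. -/
def powMul {L L' : HermLine.{w}} (e : L ≃ₗᵢ[ℂ] L') (a b c : ℤ) :
    (L.zpow a).tensor (L'.zpow b) ≃ₗᵢ[ℂ] L.zpow c :=
  isoOfUnit
    (tmul (zpowVec L.exists_unit.choose a) (zpowVec (e L.exists_unit.choose) b))
    (by
      rw [norm_tmul, norm_zpowVec L.exists_unit.choose_spec,
        norm_zpowVec (by rw [e.norm_map, L.exists_unit.choose_spec]), one_mul])
    (zpowVec L.exists_unit.choose c) (norm_zpowVec L.exists_unit.choose_spec c)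

/-- If `a + b = c`, then `powMul` takes `x^a ⊗ x^b` to `x^c` for each unit vector `x`. -/
theorem powMul_tmul {L L' : HermLine.{w}} (e : L ≃ₗᵢ[ℂ] L') {a b c : ℤ} (h : a + b = c) {x : L}
    (hx : ‖x‖ = 1) : powMul e a b c (tmul (zpowVec x a) (zpowVec (e x) b)) = zpowVec x c := by
  have hu := L.exists_unit.choose_spec
  have hu' : ‖e L.exists_unit.choose‖ = 1 := by rw [e.norm_map, hu]
  have hx' : ‖e x‖ = 1 := by rw [e.norm_map, hx]
  have hne : ⟪L.exists_unit.choose, x⟫_ℂ ≠ 0 := by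
    intro h0
    have := norm_inner_unit hu hx
    rw [h0, norm_zero] at this
    exact zero_ne_one this
  rw [zpowVec_eq hu hx c]
  simp only [powMul, isoOfUnit_apply, inner_tmul, inner_zpowVec hu hx, inner_zpowVec hu' hx',
    LinearIsometryEquiv.inner_map_map]
  rw [← zpow_add₀ hne, h]

theorem inner_dualMul {A B C : HermLine.{w}} (m : A.tensor B ≃ₗᵢ[ℂ] C) (a : A) (b : B) (c : C) :
    ⟪covec c, dualMul m (tmul (covec a) (covec b))⟫_ℂ =
      (starRingEnd ℂ) ⟪c, m (tmul a b)⟫_ℂ := by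
  rw [dualMul_covec, inner_covec, inner_conj_symm]

theorem inner_tensorMul {A B C A' B' C' : HermLine.{w}} (m : A.tensor B ≃ₗᵢ[ℂ] C)
    (m' : A'.tensor B' ≃ₗᵢ[ℂ] C') (a : A) (b : B) (c : C) (a' : A') (b' : B') (c' : C') :
    ⟪tmul c c', tensorMul m m' (tmul (tmul a a') (tmul b b'))⟫_ℂ =
      ⟪c, m (tmul a b)⟫_ℂ * ⟪c', m' (tmul a' b')⟫_ℂ := by
  rw [tensorMul_tmul, inner_tmul]

theorem inner_contract {R₁ R₂ R₃ : HermLine.{w}} {x₁ : R₁} {x₂ : R₂} {x₃ : R₃} (h₁ : ‖x₁‖ = 1)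
    (h₂ : ‖x₂‖ = 1) (h₃ : ‖x₃‖ = 1) :
    ⟪tmul x₃ (covec x₁), contract R₁ R₂ R₃ (tmul (tmul x₂ (covec x₁)) (tmul x₃ (covec x₂)))⟫_ℂ =
      1 := by
  rw [contract_tmul, inner_smul_right, inner_tmul, inner_covec, eval_covec,
    inner_self_eq_norm_sq_to_K, inner_self_eq_norm_sq_to_K, inner_self_eq_norm_sq_to_K, h₁, h₂, h₃]
  simp

theorem inner_powMul {L L' : HermLine.{w}} (e : L ≃ₗᵢ[ℂ] L') {a b c : ℤ} (h : a + b = c) {x : L}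
    {y : L'} (hx : ‖x‖ = 1) (hy : e x = y) :
    ⟪zpowVec x c, powMul e a b c (tmul (zpowVec x a) (zpowVec y b))⟫_ℂ = 1 := by
  subst hy
  rw [powMul_tmul e h hx, inner_self_eq_norm_sq_to_K, norm_zpowVec hx]
  simp

/-- The two ways of bracketing a triple product agree. -/
def Assoc {A B C AB BC ABC : HermLine.{w}} (m₁ : A.tensor B ≃ₗᵢ[ℂ] AB)
    (m₂ : AB.tensor C ≃ₗᵢ[ℂ] ABC) (m₃ : B.tensor C ≃ₗᵢ[ℂ] BC) (m₄ : A.tensor BC ≃ₗᵢ[ℂ] ABC) :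
    Prop :=
  ∀ (a : A) (b : B) (c : C), m₂ (tmul (m₁ (tmul a b)) c) = m₄ (tmul a (m₃ (tmul b c)))

theorem Assoc.of_unit {A B C AB BC ABC : HermLine.{w}} {m₁ : A.tensor B ≃ₗᵢ[ℂ] AB}
    {m₂ : AB.tensor C ≃ₗᵢ[ℂ] ABC} {m₃ : B.tensor C ≃ₗᵢ[ℂ] BC} {m₄ : A.tensor BC ≃ₗᵢ[ℂ] ABC}
    (a : A) (b : B) (c : C) (ha : ‖a‖ = 1) (hb : ‖b‖ = 1) (hc : ‖c‖ = 1)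
    (h : m₂ (tmul (m₁ (tmul a b)) c) = m₄ (tmul a (m₃ (tmul b c)))) : Assoc m₁ m₂ m₃ m₄ := by
  intro a' b' c'
  rw [eq_inner_smul ha a', eq_inner_smul hb b', eq_inner_smul hc c']
  simp only [smul_tmul_smul, map_smul]
  rw [h, mul_assoc]

theorem Assoc.dual {A B C AB BC ABC : HermLine.{w}} {m₁ : A.tensor B ≃ₗᵢ[ℂ] AB}
    {m₂ : AB.tensor C ≃ₗᵢ[ℂ] ABC} {m₃ : B.tensor C ≃ₗᵢ[ℂ] BC} {m₄ : A.tensor BC ≃ₗᵢ[ℂ] ABC}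
    (h : Assoc m₁ m₂ m₃ m₄) : Assoc (dualMul m₁) (dualMul m₂) (dualMul m₃) (dualMul m₄) := by
  intro a b c
  obtain ⟨a, rfl⟩ := exists_covec a
  obtain ⟨b, rfl⟩ := exists_covec b
  obtain ⟨c, rfl⟩ := exists_covec c
  rw [dualMul_covec, dualMul_covec, dualMul_covec, dualMul_covec, h a b c]

theorem Assoc.tensor {A B C AB BC ABC A' B' C' AB' BC' ABC' : HermLine.{w}}
    {m₁ : A.tensor B ≃ₗᵢ[ℂ] AB} {m₂ : AB.tensor C ≃ₗᵢ[ℂ] ABC} {m₃ : B.tensor C ≃ₗᵢ[ℂ] BC}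
    {m₄ : A.tensor BC ≃ₗᵢ[ℂ] ABC}
    {m₁' : A'.tensor B' ≃ₗᵢ[ℂ] AB'} {m₂' : AB'.tensor C' ≃ₗᵢ[ℂ] ABC'}
    {m₃' : B'.tensor C' ≃ₗᵢ[ℂ] BC'} {m₄' : A'.tensor BC' ≃ₗᵢ[ℂ] ABC'}
    (h : Assoc m₁ m₂ m₃ m₄) (h' : Assoc m₁' m₂' m₃' m₄') :
    Assoc (tensorMul m₁ m₁') (tensorMul m₂ m₂') (tensorMul m₃ m₃') (tensorMul m₄ m₄') := by
  have ha := A.exists_unit.choose_spec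
  have hb := B.exists_unit.choose_spec
  have hc := C.exists_unit.choose_spec
  have ha' := A'.exists_unit.choose_spec
  have hb' := B'.exists_unit.choose_spec
  have hc' := C'.exists_unit.choose_spec
  refine Assoc.of_unit (tmul A.exists_unit.choose A'.exists_unit.choose)
    (tmul B.exists_unit.choose B'.exists_unit.choose)
    (tmul C.exists_unit.choose C'.exists_unit.choose) (by rw [norm_tmul, ha, ha', one_mul])
    (by rw [norm_tmul, hb, hb', one_mul]) (by rw [norm_tmul, hc, hc', one_mul]) ?_
  rw [tensorMul_tmul, tensorMul_tmul, tensorMul_tmul, tensorMul_tmul, h, h']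

theorem contract_assoc (R₁ R₂ R₃ R₄ : HermLine.{w}) :
    Assoc (contract R₁ R₂ R₃) (contract R₁ R₃ R₄) (contract R₂ R₃ R₄) (contract R₁ R₂ R₄) := by
  have h₁ := R₁.exists_unit.choose_spec
  have h₂ := R₂.exists_unit.choose_spec
  have h₃ := R₃.exists_unit.choose_spec
  have h₄ := R₄.exists_unit.choose_spec
  refine Assoc.of_unit (tmul R₂.exists_unit.choose (covec R₁.exists_unit.choose))
    (tmul R₃.exists_unit.choose (covec R₂.exists_unit.choose))
    (tmul R₄.exists_unit.choose (covec R₃.exists_unit.choose))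
    (by rw [norm_tmul, norm_covec, h₁, h₂, one_mul])
    (by rw [norm_tmul, norm_covec, h₂, h₃, one_mul])
    (by rw [norm_tmul, norm_covec, h₃, h₄, one_mul]) ?_
  simp only [contract_tmul, eval_covec, inner_self_eq_norm_sq_to_K, h₂, h₃]
  simp [contract_tmul, inner_self_eq_norm_sq_to_K, h₂, h₃]

theorem powMul_assoc {L L' L'' : HermLine.{w}} (e : L ≃ₗᵢ[ℂ] L') (e' : L' ≃ₗᵢ[ℂ] L'')
    (e'' : L ≃ₗᵢ[ℂ] L'') (he : ∀ x, e'' x = e' (e x)) {a b c ab bc abc : ℤ} (h₁ : a + b = ab)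
    (h₂ : ab + c = abc) (h₃ : b + c = bc) :
    Assoc (powMul e a b ab) (powMul e'' ab c abc) (powMul e' b c bc) (powMul e a bc abc) := by
  have hu := L.exists_unit.choose_spec
  have hu' : ‖e L.exists_unit.choose‖ = 1 := by rw [e.norm_map, hu]
  have hu'' : ‖e' (e L.exists_unit.choose)‖ = 1 := by rw [e'.norm_map, hu']
  refine Assoc.of_unit (zpowVec L.exists_unit.choose a) (zpowVec (e L.exists_unit.choose) b)
    (zpowVec (e' (e L.exists_unit.choose)) c) (norm_zpowVec hu a) (norm_zpowVec hu' b)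
    (norm_zpowVec hu'' c) ?_
  rw [powMul_tmul e h₁ hu, powMul_tmul e' h₃ hu', powMul_tmul e (by omega) hu, ← he,
    powMul_tmul e'' h₂ hu]

end HermLine

/-- A local section of unit length in a family of hermitian lines. It is only relevant over its
domain. -/
structure UnitFrame {B : Type*} [TopologicalSpace B] (fiber : B → HermLine.{w}) where
  dom : Set B
  isOpen_dom : IsOpen dom
  sec : ∀ b, fiber b
  norm_sec : ∀ b ∈ dom, ‖sec b‖ = 1

/-- A smooth hermitian line bundle over the manifold `B`: a family of hermitian lines with an atlas
of local unit frames whose transition functions `⟪s, t⟫`, determined by `t = ⟪s, t⟫ • s`, are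
smooth. -/
structure HermitianLineBundle {E H : Type*} [NormedAddCommGroup E] [NormedSpace ℝ E]
    [TopologicalSpace H] (I : ModelWithCorners ℝ E H) (B : Type*) [TopologicalSpace B]
    [ChartedSpace H B] where
  fiber : B → HermLine.{w}
  frames : Set (UnitFrame fiber)
  cover : ∀ b, ∃ s ∈ frames, b ∈ s.dom
  smooth : ∀ s ∈ frames, ∀ t ∈ frames, ∀ b ∈ s.dom, b ∈ t.dom →
    ContMDiffAt I 𝓘(ℝ, ℂ) ∞ (fun b => ⟪s.sec b, t.sec b⟫_ℂ) b

section Bundles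

variable {E H B : Type*} [NormedAddCommGroup E] [NormedSpace ℝ E] [TopologicalSpace H]
  [TopologicalSpace B] [ChartedSpace H B] {I : ModelWithCorners ℝ E H}
  {E' H' B' : Type*} [NormedAddCommGroup E'] [NormedSpace ℝ E'] [TopologicalSpace H']
  [TopologicalSpace B'] [ChartedSpace H' B'] {I' : ModelWithCorners ℝ E' H'}

theorem ContMDiffAt.mul_complex {f g : B → ℂ} {b : B} (hf : ContMDiffAt I 𝓘(ℝ, ℂ) ∞ f b)
    (hg : ContMDiffAt I 𝓘(ℝ, ℂ) ∞ g b) : ContMDiffAt I 𝓘(ℝ, ℂ) ∞ (fun x => f x * g x) b :=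
  have h : ContDiff ℝ ∞ (fun p : ℂ × ℂ => p.1 * p.2) := contDiff_fst.mul contDiff_snd
  h.contMDiff.contMDiffAt.comp b (hf.prodMk_space hg)

theorem ContMDiffAt.zpow_complex {f : B → ℂ} {b : B} (hf : ContMDiffAt I 𝓘(ℝ, ℂ) ∞ f b)
    (h0 : f b ≠ 0) (k : ℤ) : ContMDiffAt I 𝓘(ℝ, ℂ) ∞ (fun x => f x ^ k) b := by
  have ha : AnalyticAt ℂ (fun z : ℂ => z ^ k) (f b) := analyticAt_id.zpow h0
  have hc : ContDiffAt ℂ ∞ (fun z : ℂ => z ^ k) (f b) := ha.contDiffAt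
  have h : ContDiffAt ℝ ∞ (fun z : ℂ => z ^ k) (f b) := hc.restrict_scalars ℝ
  exact h.contMDiffAt.comp b hf

theorem ContMDiffAt.conj_complex {f : B → ℂ} {b : B} (hf : ContMDiffAt I 𝓘(ℝ, ℂ) ∞ f b) :
    ContMDiffAt I 𝓘(ℝ, ℂ) ∞ (fun x => (starRingEnd ℂ) (f x)) b := by
  have h : ContDiff ℝ ∞ (fun z : ℂ => (starRingEnd ℂ) z) := Complex.conjCLE.contDiff
  exact h.contMDiff.contMDiffAt.comp b hf

namespace HermitianLineBundle

/-- A fibrewise isometric isomorphism between two line bundles is smooth. -/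
def IsSmooth (L L' : HermitianLineBundle.{w} I B) (φ : ∀ b, L.fiber b ≃ₗᵢ[ℂ] L'.fiber b) : Prop :=
  ∀ s ∈ L.frames, ∀ t ∈ L'.frames, ∀ b ∈ s.dom, b ∈ t.dom →
    ContMDiffAt I 𝓘(ℝ, ℂ) ∞ (fun b => ⟪t.sec b, φ b (s.sec b)⟫_ℂ) b

/-- An isomorphism of smooth hermitian line bundles over `B`. -/
structure Iso (L L' : HermitianLineBundle.{w} I B) where
  equiv : ∀ b, L.fiber b ≃ₗᵢ[ℂ] L'.fiber b
  smooth : IsSmooth L L' equiv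

/-- Smoothness can be checked in one pair of frames near each point. -/
theorem isSmooth_of_exists {L L' : HermitianLineBundle.{w} I B}
    {φ : ∀ b, L.fiber b ≃ₗᵢ[ℂ] L'.fiber b}
    (h : ∀ b, ∃ s ∈ L.frames, ∃ t ∈ L'.frames, b ∈ s.dom ∧ b ∈ t.dom ∧
      ContMDiffAt I 𝓘(ℝ, ℂ) ∞ (fun b => ⟪t.sec b, φ b (s.sec b)⟫_ℂ) b) : IsSmooth L L' φ := by
  intro s' hs' t' ht' b hbs' hbt'
  obtain ⟨s, hs, t, ht, hbs, hbt, hst⟩ := h b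
  refine (((L'.smooth t' ht' t ht b hbt' hbt).mul_complex hst).mul_complex
    (L.smooth s hs s' hs' b hbs hbs')).congr_of_eventuallyEq ?_
  filter_upwards [s.isOpen_dom.mem_nhds hbs, t.isOpen_dom.mem_nhds hbt] with x hxs hxt
  have h1 := HermLine.eq_inner_smul (s.norm_sec x hxs) (s'.sec x)
  have h2 := HermLine.eq_inner_smul (t.norm_sec x hxt) (φ x (s.sec x))
  conv_lhs => rw [h1, map_smul, inner_smul_right, h2, inner_smul_right]
  ring

/-- The pullback of a hermitian line bundle along a smooth map. -/
def pullback (L : HermitianLineBundle.{w} I B) (φ : B' → B) (hφ : ContMDiff I' I ∞ φ) :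
    HermitianLineBundle.{w} I' B' where
  fiber b := L.fiber (φ b)
  frames := {u | ∃ s ∈ L.frames, u = ⟨φ ⁻¹' s.dom, s.isOpen_dom.preimage hφ.continuous,
    fun b => s.sec (φ b), fun b hb => s.norm_sec (φ b) hb⟩}
  cover b := by
    obtain ⟨s, hs, hb⟩ := L.cover (φ b)
    exact ⟨_, ⟨s, hs, rfl⟩, hb⟩
  smooth := by
    rintro _ ⟨s, hs, rfl⟩ _ ⟨t, ht, rfl⟩ b hbs hbt
    exact (L.smooth s hs t ht (φ b) hbs hbt).comp b (hφ b)

/-- The tensor product of hermitian line bundles. -/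
def tensor (L L' : HermitianLineBundle.{w} I B) : HermitianLineBundle.{w} I B where
  fiber b := (L.fiber b).tensor (L'.fiber b)
  frames := {u | ∃ s ∈ L.frames, ∃ t ∈ L'.frames, u = ⟨s.dom ∩ t.dom,
    s.isOpen_dom.inter t.isOpen_dom, fun b => HermLine.tmul (s.sec b) (t.sec b), fun b hb => by
      rw [HermLine.norm_tmul, s.norm_sec b hb.1, t.norm_sec b hb.2, one_mul]⟩}
  cover b := by
    obtain ⟨s, hs, hbs⟩ := L.cover b
    obtain ⟨t, ht, hbt⟩ := L'.cover b
    exact ⟨_, ⟨s, hs, t, ht, rfl⟩, hbs, hbt⟩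
  smooth := by
    rintro _ ⟨s, hs, t, ht, rfl⟩ _ ⟨s', hs', t', ht', rfl⟩ b hb hb'
    simp only [HermLine.inner_tmul]
    exact (L.smooth s hs s' hs' b hb.1 hb'.1).mul_complex (L'.smooth t ht t' ht' b hb.2 hb'.2)

/-- The dual of a hermitian line bundle. -/
def dual (L : HermitianLineBundle.{w} I B) : HermitianLineBundle.{w} I B where
  fiber b := (L.fiber b).dual
  frames := {u | ∃ s ∈ L.frames, u = ⟨s.dom, s.isOpen_dom, fun b => HermLine.covec (s.sec b),
    fun b hb => by rw [HermLine.norm_covec, s.norm_sec b hb]⟩}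
  cover b := by
    obtain ⟨s, hs, hbs⟩ := L.cover b
    exact ⟨_, ⟨s, hs, rfl⟩, hbs⟩
  smooth := by
    rintro _ ⟨s, hs, rfl⟩ _ ⟨t, ht, rfl⟩ b hbs hbt
    simp only [HermLine.inner_covec]
    exact L.smooth t ht s hs b hbt hbs

/-- The bundle with fibre `(L_b)^(f b)` at `b`, for a smooth function `f : B → ℤ`. -/
def pow (L : HermitianLineBundle.{w} I B) (f : LocallyConstant B ℤ) :
    HermitianLineBundle.{w} I B where
  fiber b := (L.fiber b).zpow (f b)
  frames := {u | ∃ s ∈ L.frames, u = ⟨s.dom, s.isOpen_dom,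
    fun b => HermLine.zpowVec (s.sec b) (f b),
    fun b hb => HermLine.norm_zpowVec (s.norm_sec b hb) (f b)⟩}
  cover b := by
    obtain ⟨s, hs, hbs⟩ := L.cover b
    exact ⟨_, ⟨s, hs, rfl⟩, hbs⟩
  smooth := by
    rintro _ ⟨s, hs, rfl⟩ _ ⟨t, ht, rfl⟩ b hbs hbt
    have h0 : ⟪s.sec b, t.sec b⟫_ℂ ≠ 0 := fun h => by
      have := HermLine.norm_inner_unit (s.norm_sec b hbs) (t.norm_sec b hbt)
      rw [h, norm_zero] at this
      exact zero_ne_one this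
    refine ((L.smooth s hs t ht b hbs hbt).zpow_complex h0 (f b)).congr_of_eventuallyEq ?_
    filter_upwards [s.isOpen_dom.mem_nhds hbs, t.isOpen_dom.mem_nhds hbt,
      (f.isLocallyConstant.eventually_eq b)] with x hxs hxt hx
    rw [HermLine.inner_zpowVec (s.norm_sec x hxs) (t.norm_sec x hxt)]
    exact congrArg _ hx

/-- The function power `L^f → B' × B` of a line bundle `L → B`, with fibre `(L_b)^(f b')` at
`(b', b)` for `f : B' → ℤ`, or more generally fibre `(L_b)^(f (b', b))` for `f : B' × B → ℤ`. -/
def funPow (L : HermitianLineBundle.{w} I B) (f : LocallyConstant (B' × B) ℤ) :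
    HermitianLineBundle.{w} (I'.prod I) (B' × B) :=
  (L.pullback (Prod.snd : B' × B → B) (contMDiff_snd (I := I') (J := I))).pow f

/-- The tensor product `L 0 ⊗ ⋯ ⊗ L n`. -/
def tensorFin : (n : ℕ) → (Fin (n + 1) → HermitianLineBundle.{w} I B) →
    HermitianLineBundle.{w} I B
  | 0, L => L 0
  | n + 1, L => (tensorFin n fun i => L i.castSucc).tensor (L (Fin.last (n + 1)))

/-- The identity map of the fibre, between two names `b`, `b'` of the same point. -/
def transport (L : HermitianLineBundle.{w} I B) {b b' : B} (h : b = b') :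
    L.fiber b ≃ₗᵢ[ℂ] L.fiber b' :=
  h ▸ LinearIsometryEquiv.refl ℂ (L.fiber b)

theorem transport_sec (L : HermitianLineBundle.{w} I B) (s : ∀ b, L.fiber b) {b b' : B}
    (h : b = b') : L.transport h (s b) = s b' := by
  subst h; rfl

theorem transport_transport (L : HermitianLineBundle.{w} I B) {b b' b'' : B} (h : b = b')
    (h' : b' = b'') (x : L.fiber b) : L.transport h' (L.transport h x) =
      L.transport (h.trans h') x := by
  subst h; subst h'; rfl

end HermitianLineBundle

end Bundles

section Gerbes

variable {EM HM M : Type*} [NormedAddCommGroup EM] [NormedSpace ℝ EM] [TopologicalSpace HM]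
  [TopologicalSpace M] [ChartedSpace HM M] {IM : ModelWithCorners ℝ EM HM}
  {EX HX X : Type*} [NormedAddCommGroup EX] [NormedSpace ℝ EX] [TopologicalSpace HX]
  [TopologicalSpace X] [ChartedSpace HX X] {IX : ModelWithCorners ℝ EX HX}
  {EY HY Y : Type*} [NormedAddCommGroup EY] [NormedSpace ℝ EY] [TopologicalSpace HY]
  [TopologicalSpace Y] [ChartedSpace HY Y] {IY : ModelWithCorners ℝ EY HY}
  {EN HN N : Type*} [NormedAddCommGroup EN] [NormedSpace ℝ EN] [TopologicalSpace HN]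
  [TopologicalSpace N] [ChartedSpace HN N] {IN : ModelWithCorners ℝ EN HN}
  {πX : X → M} {πY : Y → M}

/-- `Y^{[2]} = Y ×_M Y`. -/
abbrev Fib2 (hY : IsSurjectiveSubmersion IY IM πY) : Type _ := FibProd hY hY

section

variable [IY.Boundaryless] [IsManifold IY ∞ Y] [IX.Boundaryless] [IsManifold IX ∞ X]

/-- `Y^{[3]} = (Y ×_M Y) ×_M Y`. -/
abbrev Fib3 (hY : IsSurjectiveSubmersion IY IM πY) : Type _ := FibProd (hY.fibProd hY) hY

/-- The model of `Y^{[2]}`. -/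
abbrev Fib2.model (hY : IsSurjectiveSubmersion IY IM πY) :
    ModelWithCorners ℝ (EY × hY.Fib) (ModelProd HY hY.Fib) := FibProd.model IY hY

/-- The model of `Y^{[3]}`. -/
abbrev Fib3.model (hY : IsSurjectiveSubmersion IY IM πY) :
    ModelWithCorners ℝ ((EY × hY.Fib) × hY.Fib) (ModelProd (ModelProd HY hY.Fib) hY.Fib) :=
  FibProd.model (FibProd.model IY hY) hY

variable (hY : IsSurjectiveSubmersion IY IM πY)

/-- `(y₁, y₂) ∈ Y^{[2]}`. -/
def Fib2.mk (y₁ y₂ : Y) (h : πY y₁ = πY y₂) : Fib2 hY := FibProd.mk hY hY y₁ y₂ h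

/-- `(y₁, y₂, y₃) ∈ Y^{[3]}`. -/
def Fib3.mk (y₁ y₂ y₃ : Y) (h₁₂ : πY y₁ = πY y₂) (h₂₃ : πY y₂ = πY y₃) : Fib3 hY :=
  FibProd.mk (hY.fibProd hY) hY (Fib2.mk hY y₁ y₂ h₁₂) y₃ (h₁₂.trans h₂₃)

/-- `(y₁, y₂, y₃) ↦ (y₁, y₂)`, the projection `π₃`. -/
def p12 (z : Fib3 hY) : Fib2 hY := z.fst

/-- `(y₁, y₂, y₃) ↦ (y₂, y₃)`, the projection `π₁`. -/
def p23 (z : Fib3 hY) : Fib2 hY := Fib2.mk hY z.fst.snd z.snd (z.fst.comm.symm.trans z.comm)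

/-- `(y₁, y₂, y₃) ↦ (y₁, y₃)`, the projection `π₂`. -/
def p13 (z : Fib3 hY) : Fib2 hY := Fib2.mk hY z.fst.fst z.snd z.comm

theorem contMDiff_p12 : ContMDiff (Fib3.model hY) (Fib2.model hY) ∞ (p12 hY) :=
  FibProd.contMDiff_fst

theorem contMDiff_p23 : ContMDiff (Fib3.model hY) (Fib2.model hY) ∞ (p23 hY) :=
  FibProd.contMDiff_mk (FibProd.contMDiff_snd.comp FibProd.contMDiff_fst) FibProd.contMDiff_snd _

theorem contMDiff_p13 : ContMDiff (Fib3.model hY) (Fib2.model hY) ∞ (p13 hY) :=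
  FibProd.contMDiff_mk (FibProd.contMDiff_fst.comp FibProd.contMDiff_fst) FibProd.contMDiff_snd _

/-- `δ(f) = 0`, for a smooth function `f : Y^{[2]} → ℤ`. -/
def IsCocycle (f : LocallyConstant (Fib2 hY) ℤ) : Prop :=
  ∀ z : Fib3 hY, f (p23 hY z) - f (p13 hY z) + f (p12 hY z) = 0

theorem IsCocycle.add_eq {hY : IsSurjectiveSubmersion IY IM πY}
    {f : LocallyConstant (Fib2 hY) ℤ} (hf : IsCocycle hY f) (y₁ y₂ y₃ : Y) (h₁₂ : πY y₁ = πY y₂)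
    (h₂₃ : πY y₂ = πY y₃) : f (Fib2.mk hY y₁ y₂ h₁₂) + f (Fib2.mk hY y₂ y₃ h₂₃) =
      f (Fib2.mk hY y₁ y₃ (h₁₂.trans h₂₃)) := by
  have h := hf (Fib3.mk hY y₁ y₂ y₃ h₁₂ h₂₃)
  have h' : f (Fib2.mk hY y₂ y₃ h₂₃) - f (Fib2.mk hY y₁ y₃ (h₁₂.trans h₂₃)) +
    f (Fib2.mk hY y₁ y₂ h₁₂) = 0 := h
  linarith

/-- A family of isometric isomorphisms `L_(y₁, y₂) ⊗ L_(y₂, y₃) → L_(y₁, y₃)` is a smooth isomorphism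
of hermitian line bundles `π₃⁻¹ L ⊗ π₁⁻¹ L → π₂⁻¹ L` over `Y^{[3]}`. -/
def IsSmoothMul {hY : IsSurjectiveSubmersion IY IM πY}
    (L : HermitianLineBundle.{w} (Fib2.model hY) (Fib2 hY))
    (m : ∀ z : Fib3 hY, (L.fiber (p12 hY z)).tensor (L.fiber (p23 hY z)) ≃ₗᵢ[ℂ]
      L.fiber (p13 hY z)) : Prop :=
  HermitianLineBundle.IsSmooth ((L.pullback (p12 hY) (contMDiff_p12 hY)).tensor
    (L.pullback (p23 hY) (contMDiff_p23 hY))) (L.pullback (p13 hY) (contMDiff_p13 hY)) m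

/-- A bundle gerbe over `M` with respect to the surjective submersion `Y → M`: a hermitian line
bundle `P → Y^{[2]}` and an associative multiplication
`P_(y₁, y₂) ⊗ P_(y₂, y₃) → P_(y₁, y₃)`, a smooth isomorphism of hermitian line bundles over
`Y^{[3]}`. -/
structure BundleGerbe where
  line : HermitianLineBundle.{w} (Fib2.model hY) (Fib2 hY)
  mul : ∀ z : Fib3 hY, (line.fiber (p12 hY z)).tensor (line.fiber (p23 hY z)) ≃ₗᵢ[ℂ]
    line.fiber (p13 hY z)
  smooth : IsSmoothMul line mul
  assoc : ∀ (y₁ y₂ y₃ y₄ : Y) (h₁₂ : πY y₁ = πY y₂) (h₂₃ : πY y₂ = πY y₃) (h₃₄ : πY y₃ = πY y₄),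
    HermLine.Assoc (mul (Fib3.mk hY y₁ y₂ y₃ h₁₂ h₂₃))
      (mul (Fib3.mk hY y₁ y₃ y₄ (h₁₂.trans h₂₃) h₃₄))
      (mul (Fib3.mk hY y₂ y₃ y₄ h₂₃ h₃₄))
      (mul (Fib3.mk hY y₁ y₂ y₄ h₁₂ (h₂₃.trans h₃₄)))

variable {hY} {hX : IsSurjectiveSubmersion IX IM πX}

theorem IsSmoothMul.contMDiffAt {L : HermitianLineBundle.{w} (Fib2.model hY) (Fib2 hY)}
    {m : ∀ z : Fib3 hY, (L.fiber (p12 hY z)).tensor (L.fiber (p23 hY z)) ≃ₗᵢ[ℂ]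
      L.fiber (p13 hY z)} (hm : IsSmoothMul L m) {s t u : UnitFrame L.fiber}
    (hs : s ∈ L.frames) (ht : t ∈ L.frames) (hu : u ∈ L.frames) {z : Fib3 hY}
    (hzs : p12 hY z ∈ s.dom) (hzt : p23 hY z ∈ t.dom) (hzu : p13 hY z ∈ u.dom) :
    ContMDiffAt (Fib3.model hY) 𝓘(ℝ, ℂ) ∞ (fun z => ⟪u.sec (p13 hY z),
      m z (HermLine.tmul (s.sec (p12 hY z)) (t.sec (p23 hY z)))⟫_ℂ) z :=
  hm _ ⟨_, ⟨s, hs, rfl⟩, _, ⟨t, ht, rfl⟩, rfl⟩ _ ⟨u, hu, rfl⟩ z ⟨hzs, hzt⟩ hzu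

theorem isSmoothMul_of_exists {L : HermitianLineBundle.{w} (Fib2.model hY) (Fib2 hY)}
    {m : ∀ z : Fib3 hY, (L.fiber (p12 hY z)).tensor (L.fiber (p23 hY z)) ≃ₗᵢ[ℂ]
      L.fiber (p13 hY z)}
    (h : ∀ z, ∃ s ∈ L.frames, ∃ t ∈ L.frames, ∃ u ∈ L.frames, p12 hY z ∈ s.dom ∧
      p23 hY z ∈ t.dom ∧ p13 hY z ∈ u.dom ∧
      ContMDiffAt (Fib3.model hY) 𝓘(ℝ, ℂ) ∞ (fun z => ⟪u.sec (p13 hY z),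
        m z (HermLine.tmul (s.sec (p12 hY z)) (t.sec (p23 hY z)))⟫_ℂ) z) :
    IsSmoothMul L m := by
  apply HermitianLineBundle.isSmooth_of_exists
  intro z
  obtain ⟨s, hs, t, ht, u, hu, hzs, hzt, hzu, h⟩ := h z
  exact ⟨_, ⟨_, ⟨s, hs, rfl⟩, _, ⟨t, ht, rfl⟩, rfl⟩, _, ⟨u, hu, rfl⟩, ⟨hzs, hzt⟩, hzu, h⟩

namespace BundleGerbe

/-- The product of `a ∈ P_(y₁, y₂)` and `b ∈ P_(y₂, y₃)`. -/
def prod (P : BundleGerbe.{w} hY) (z : Fib3 hY) (a : P.line.fiber (p12 hY z))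
    (b : P.line.fiber (p23 hY z)) : P.line.fiber (p13 hY z) :=
  P.mul z (HermLine.tmul a b)

/-- An isomorphism of bundle gerbes over `M` with respect to `Y → M`: an isomorphism of line
bundles that respects the multiplications. -/
structure Iso (P Q : BundleGerbe.{w} hY) where
  line : P.line.Iso Q.line
  map_prod : ∀ (z : Fib3 hY) (a : P.line.fiber (p12 hY z)) (b : P.line.fiber (p23 hY z)),
    line.equiv (p13 hY z) (P.prod z a b) =
      Q.prod z (line.equiv (p12 hY z) a) (line.equiv (p23 hY z) b)

/-- The dual bundle gerbe. -/
def dual (P : BundleGerbe.{w} hY) : BundleGerbe.{w} hY where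
  line := P.line.dual
  mul z := HermLine.dualMul (P.mul z)
  smooth := by
    apply isSmoothMul_of_exists
    intro z
    obtain ⟨s, hs, hzs⟩ := P.line.cover (p12 hY z)
    obtain ⟨t, ht, hzt⟩ := P.line.cover (p23 hY z)
    obtain ⟨u, hu, hzu⟩ := P.line.cover (p13 hY z)
    refine ⟨_, ⟨s, hs, rfl⟩, _, ⟨t, ht, rfl⟩, _, ⟨u, hu, rfl⟩, hzs, hzt, hzu, ?_⟩
    refine (P.smooth.contMDiffAt hs ht hu hzs hzt hzu).conj_complex.congr_of_eventuallyEq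
      (Filter.Eventually.of_forall fun x => ?_)
    exact HermLine.inner_dualMul _ _ _ _
  assoc y₁ y₂ y₃ y₄ h₁₂ h₂₃ h₃₄ := (P.assoc y₁ y₂ y₃ y₄ h₁₂ h₂₃ h₃₄).dual

/-- The reduced product `P ⊗_red Q` of two bundle gerbes with respect to the same `Y → M`, with
fibres `P_(y₁, y₂) ⊗ Q_(y₁, y₂)`. -/
def redProd (P Q : BundleGerbe.{w} hY) : BundleGerbe.{w} hY where
  line := P.line.tensor Q.line
  mul z := HermLine.tensorMul (P.mul z) (Q.mul z)
  smooth := by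
    apply isSmoothMul_of_exists
    intro z
    obtain ⟨s, hs, hzs⟩ := P.line.cover (p12 hY z)
    obtain ⟨t, ht, hzt⟩ := P.line.cover (p23 hY z)
    obtain ⟨u, hu, hzu⟩ := P.line.cover (p13 hY z)
    obtain ⟨s', hs', hzs'⟩ := Q.line.cover (p12 hY z)
    obtain ⟨t', ht', hzt'⟩ := Q.line.cover (p23 hY z)
    obtain ⟨u', hu', hzu'⟩ := Q.line.cover (p13 hY z)
    refine ⟨_, ⟨s, hs, s', hs', rfl⟩, _, ⟨t, ht, t', ht', rfl⟩, _, ⟨u, hu, u', hu', rfl⟩,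
      ⟨hzs, hzs'⟩, ⟨hzt, hzt'⟩, ⟨hzu, hzu'⟩, ?_⟩
    refine ((P.smooth.contMDiffAt hs ht hu hzs hzt hzu).mul_complex
      (Q.smooth.contMDiffAt hs' ht' hu' hzs' hzt' hzu')).congr_of_eventuallyEq
      (Filter.Eventually.of_forall fun x => ?_)
    exact HermLine.inner_tensorMul _ _ _ _ _ _ _ _
  assoc y₁ y₂ y₃ y₄ h₁₂ h₂₃ h₃₄ :=
    (P.assoc y₁ y₂ y₃ y₄ h₁₂ h₂₃ h₃₄).tensor (Q.assoc y₁ y₂ y₃ y₄ h₁₂ h₂₃ h₃₄)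

end BundleGerbe

/-- The map `X^{[2]} → Y^{[2]}` induced by a map `X → Y` over `M`. -/
def sqMap (σ : X → Y) (hσM : ∀ x, πY (σ x) = πX x) (z : Fib2 hX) : Fib2 hY :=
  Fib2.mk hY (σ z.fst) (σ z.snd) ((hσM _).trans (z.comm.trans (hσM _).symm))

/-- The map `X^{[3]} → Y^{[3]}` induced by a map `X → Y` over `M`. -/
def cubeMap (σ : X → Y) (hσM : ∀ x, πY (σ x) = πX x) (z : Fib3 hX) : Fib3 hY :=
  Fib3.mk hY (σ z.fst.fst) (σ z.fst.snd) (σ z.snd)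
    ((hσM _).trans (z.fst.comm.trans (hσM _).symm))
    ((hσM _).trans (z.fst.comm.symm.trans (z.comm.trans (hσM _).symm)))

theorem contMDiff_sqMap {σ : X → Y} (hσ : ContMDiff IX IY ∞ σ) (hσM : ∀ x, πY (σ x) = πX x) :
    ContMDiff (Fib2.model hX) (Fib2.model hY) ∞ (sqMap (hX := hX) (hY := hY) σ hσM) :=
  FibProd.contMDiff_mk (hσ.comp FibProd.contMDiff_fst) (hσ.comp FibProd.contMDiff_snd) _

theorem contMDiff_cubeMap {σ : X → Y} (hσ : ContMDiff IX IY ∞ σ) (hσM : ∀ x, πY (σ x) = πX x) :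
    ContMDiff (Fib3.model hX) (Fib3.model hY) ∞ (cubeMap (hX := hX) (hY := hY) σ hσM) :=
  FibProd.contMDiff_mk (hX := hY.fibProd hY)
    ((contMDiff_sqMap hσ hσM).comp (contMDiff_p12 hX)) (hσ.comp FibProd.contMDiff_snd) _

namespace BundleGerbe

/-- The pullback of a bundle gerbe with respect to `Y → M` along a smooth map `X → Y` over `M`. -/
def pullback (P : BundleGerbe.{w} hY) (hX : IsSurjectiveSubmersion IX IM πX) (σ : X → Y)
    (hσ : ContMDiff IX IY ∞ σ) (hσM : ∀ x, πY (σ x) = πX x) : BundleGerbe.{w} hX where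
  line := P.line.pullback (sqMap σ hσM) (contMDiff_sqMap hσ hσM)
  mul z := P.mul (cubeMap σ hσM z)
  smooth := by
    apply isSmoothMul_of_exists
    intro z
    obtain ⟨s, hs, hzs⟩ := P.line.cover (p12 hY (cubeMap σ hσM z))
    obtain ⟨t, ht, hzt⟩ := P.line.cover (p23 hY (cubeMap σ hσM z))
    obtain ⟨u, hu, hzu⟩ := P.line.cover (p13 hY (cubeMap σ hσM z))
    refine ⟨_, ⟨s, hs, rfl⟩, _, ⟨t, ht, rfl⟩, _, ⟨u, hu, rfl⟩, hzs, hzt, hzu, ?_⟩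
    exact (P.smooth.contMDiffAt hs ht hu hzs hzt hzu).comp z (contMDiff_cubeMap hσ hσM z)
  assoc y₁ y₂ y₃ y₄ h₁₂ h₂₃ h₃₄ := P.assoc (σ y₁) (σ y₂) (σ y₃) (σ y₄) _ _ _

/-- The product `P ⊗ Q` of a bundle gerbe with respect to `X → M` and a bundle gerbe with respect
to `Y → M`; it is a bundle gerbe with respect to `X ×_M Y → M`, with fibre
`P_(x₁, x₂) ⊗ Q_(y₁, y₂)` at `((x₁, y₁), (x₂, y₂))`. -/
def product (P : BundleGerbe.{w} hX) (Q : BundleGerbe.{w} hY) :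
    BundleGerbe.{w} (hX.fibProd hY) :=
  (P.pullback (hX.fibProd hY) FibProd.fst FibProd.contMDiff_fst fun _ => rfl).redProd
    (Q.pullback (hX.fibProd hY) FibProd.snd FibProd.contMDiff_snd fun p => p.comm.symm)

/-- The trivial bundle gerbe `δ(R)` of a hermitian line bundle `R → Y`: its fibre at `(y₁, y₂)` is
`R_y₂ ⊗ R_y₁*`, and its multiplication is the contraction. -/
def trivial (hY : IsSurjectiveSubmersion IY IM πY) (R : HermitianLineBundle.{w} IY Y) :
    BundleGerbe.{w} hY where
  line := (R.pullback FibProd.snd FibProd.contMDiff_snd).tensor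
    (R.pullback FibProd.fst FibProd.contMDiff_fst).dual
  mul z := HermLine.contract (R.fiber z.fst.fst) (R.fiber z.fst.snd) (R.fiber z.snd)
  smooth := by
    apply isSmoothMul_of_exists
    intro z
    obtain ⟨s₁, hs₁, hz₁⟩ := R.cover z.fst.fst
    obtain ⟨s₂, hs₂, hz₂⟩ := R.cover z.fst.snd
    obtain ⟨s₃, hs₃, hz₃⟩ := R.cover z.snd
    refine ⟨_, ⟨_, ⟨s₂, hs₂, rfl⟩, _, ⟨_, ⟨s₁, hs₁, rfl⟩, rfl⟩, rfl⟩,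
      _, ⟨_, ⟨s₃, hs₃, rfl⟩, _, ⟨_, ⟨s₂, hs₂, rfl⟩, rfl⟩, rfl⟩,
      _, ⟨_, ⟨s₃, hs₃, rfl⟩, _, ⟨_, ⟨s₁, hs₁, rfl⟩, rfl⟩, rfl⟩,
      ⟨hz₂, hz₁⟩, ⟨hz₃, hz₂⟩, ⟨hz₃, hz₁⟩, ?_⟩
    refine (contMDiffAt_const (c := (1 : ℂ))).congr_of_eventuallyEq ?_
    have hf := (contMDiff_p12 hY).continuous
    have h1 : Continuous fun z : Fib3 hY => z.fst.fst := FibProd.continuous_fst.comp hf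
    have h2 : Continuous fun z : Fib3 hY => z.fst.snd := FibProd.continuous_snd.comp hf
    have h3 : Continuous fun z : Fib3 hY => z.snd := FibProd.continuous_snd
    filter_upwards [(s₁.isOpen_dom.preimage h1).mem_nhds hz₁,
      (s₂.isOpen_dom.preimage h2).mem_nhds hz₂, (s₃.isOpen_dom.preimage h3).mem_nhds hz₃]
      with x hx₁ hx₂ hx₃
    exact HermLine.inner_contract (s₁.norm_sec _ hx₁) (s₂.norm_sec _ hx₂) (s₃.norm_sec _ hx₃)
  assoc y₁ y₂ y₃ y₄ _ _ _ :=
    HermLine.contract_assoc (R.fiber y₁) (R.fiber y₂) (R.fiber y₃) (R.fiber y₄)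

/-- The hermitian line bundle `R` is a trivialising line bundle of `P`. -/
def IsTrivialisedBy (P : BundleGerbe.{w} hY) (R : HermitianLineBundle.{w} IY Y) : Prop :=
  Nonempty (P.Iso (trivial hY R))

/-- The bundle gerbe `P` is trivial. -/
def IsTrivial (P : BundleGerbe.{w} hY) : Prop :=
  ∃ R : HermitianLineBundle.{w} IY Y, P.IsTrivialisedBy R

/-- The bundle gerbes `P` and `Q` over `M` are stably isomorphic: `P* ⊗ Q` is trivial. -/
def StablyIsomorphic (P : BundleGerbe.{w} hX) (Q : BundleGerbe.{w} hY) : Prop :=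
  (P.dual.product Q).IsTrivial

/-- The reduced product `G 0 ⊗_red ⋯ ⊗_red G n`. -/
def redProdFin : (n : ℕ) → (Fin (n + 1) → BundleGerbe.{w} hY) → BundleGerbe.{w} hY
  | 0, G => G 0
  | n + 1, G => (redProdFin n fun i => G i.castSucc).redProd (G (Fin.last (n + 1)))

end BundleGerbe
end
end Gerbes

section CupProduct

variable {EM HM M : Type*} [NormedAddCommGroup EM] [NormedSpace ℝ EM] [TopologicalSpace HM]
  [TopologicalSpace M] [ChartedSpace HM M] {IM : ModelWithCorners ℝ EM HM} [IsManifold IM ∞ M]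
  {EX HX X : Type*} [NormedAddCommGroup EX] [NormedSpace ℝ EX] [TopologicalSpace HX]
  [TopologicalSpace X] [ChartedSpace HX X] {IX : ModelWithCorners ℝ EX HX}
  [IX.Boundaryless] [IsManifold IX ∞ X]
  {EY HY Y : Type*} [NormedAddCommGroup EY] [NormedSpace ℝ EY] [TopologicalSpace HY]
  [TopologicalSpace Y] [ChartedSpace HY Y] {IY : ModelWithCorners ℝ EY HY}
  [IY.Boundaryless] [IsManifold IY ∞ Y]
  {EN HN N : Type*} [NormedAddCommGroup EN] [NormedSpace ℝ EN] [TopologicalSpace HN]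
  [TopologicalSpace N] [ChartedSpace HN N] {IN : ModelWithCorners ℝ EN HN}
  [IN.Boundaryless] [IsManifold IN ∞ N]
  {πX : X → M} {πY : Y → M}

section

variable (N) (IN) (hY : IsSurjectiveSubmersion IY IM πY)

/-- The identification of `(Y × N)^{[2]}`, taken over `M × N`, with `Y^{[2]} × N`, that is
`((y₁, n), (y₂, n)) ↦ ((y₁, y₂), n)`. -/
def cupProj (z : Fib2 (hY.prodId (N := N) (IN := IN))) : Fib2 hY × N :=
  (Fib2.mk hY z.fst.1 z.snd.1 (congrArg Prod.fst z.comm), z.fst.2)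

theorem contMDiff_cupProj : ContMDiff (Fib2.model (hY.prodId (N := N) (IN := IN)))
    ((Fib2.model hY).prod IN) ∞ (cupProj N IN hY) :=
  (FibProd.contMDiff_mk (contMDiff_fst.comp FibProd.contMDiff_fst)
    (contMDiff_fst.comp FibProd.contMDiff_snd) _).prodMk
    (contMDiff_snd.comp FibProd.contMDiff_fst)

end

/-- The function `(b, n) ↦ f b`. -/
def LocallyConstant.fstExt {B : Type*} [TopologicalSpace B] (f : LocallyConstant B ℤ) :
    LocallyConstant (B × N) ℤ :=
  f.comap ⟨Prod.fst, continuous_fst⟩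

/-- The general cup product bundle gerbe `(K^f, Y × N)` over `M × N` of a smooth function
`f : Y^{[2]} → ℤ` with `δ(f) = 0` and a hermitian line bundle `K → N`. The fibre over
`((y₁, n), (y₂, n))` is `(K_n)^(f (y₁, y₂))` and the multiplication is the canonical isomorphism
`(K_n)^(f (y₁, y₂)) ⊗ (K_n)^(f (y₂, y₃)) → (K_n)^(f (y₁, y₃))`. -/
def cupProductGerbe {hY : IsSurjectiveSubmersion IY IM πY} (K : HermitianLineBundle.{w} IN N)
    (f : LocallyConstant (Fib2 hY) ℤ) (hf : IsCocycle hY f) :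
    BundleGerbe.{w} (hY.prodId (N := N) (IN := IN)) where
  line := (K.funPow (I' := Fib2.model hY) f.fstExt).pullback (cupProj N IN hY)
    (contMDiff_cupProj N IN hY)
  mul z := HermLine.powMul (K.transport (b := z.fst.fst.2) (b' := z.fst.snd.2)
    (congrArg Prod.snd z.fst.comm :)) _ _ _
  smooth := by
    apply isSmoothMul_of_exists
    intro z
    obtain ⟨s, hs, hz⟩ := K.cover z.fst.fst.2
    have hz2 : z.fst.snd.2 ∈ s.dom := by
      have h : z.fst.fst.2 = z.fst.snd.2 := (congrArg Prod.snd z.fst.comm :)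
      rwa [← h]
    refine ⟨_, ⟨_, ⟨_, ⟨s, hs, rfl⟩, rfl⟩, rfl⟩, _, ⟨_, ⟨_, ⟨s, hs, rfl⟩, rfl⟩, rfl⟩,
      _, ⟨_, ⟨_, ⟨s, hs, rfl⟩, rfl⟩, rfl⟩, hz, hz2, hz, ?_⟩
    refine (contMDiffAt_const (c := (1 : ℂ))).congr_of_eventuallyEq ?_
    have hc : Continuous fun z : Fib3 (hY.prodId (N := N) (IN := IN)) => z.fst.fst.2 :=
      continuous_snd.comp (FibProd.continuous_fst.comp (contMDiff_p12 _).continuous)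
    filter_upwards [(s.isOpen_dom.preimage hc).mem_nhds hz] with x hx
    exact HermLine.inner_powMul _
      (hf.add_eq x.fst.fst.1 x.fst.snd.1 x.snd.1 (congrArg Prod.fst x.fst.comm)
        ((congrArg Prod.fst x.fst.comm).symm.trans (congrArg Prod.fst x.comm)))
      (s.norm_sec _ hx) (K.transport_sec s.sec _)
  assoc y₁ y₂ y₃ y₄ h₁₂ h₂₃ h₃₄ :=
    HermLine.powMul_assoc (K.transport (congrArg Prod.snd h₁₂))
      (K.transport (congrArg Prod.snd h₂₃)) (K.transport (congrArg Prod.snd (h₁₂.trans h₂₃)))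
      (fun x => (K.transport_transport _ _ x).symm)
      (hf.add_eq y₁.1 y₂.1 y₃.1 (congrArg Prod.fst h₁₂) (congrArg Prod.fst h₂₃))
      (hf.add_eq y₁.1 y₃.1 y₄.1 (congrArg Prod.fst (h₁₂.trans h₂₃)) (congrArg Prod.fst h₃₄))
      (hf.add_eq y₂.1 y₃.1 y₄.1 (congrArg Prod.fst h₂₃) (congrArg Prod.fst h₃₄))

section

variable (N) (IN) (hX : IsSurjectiveSubmersion IX IM πX) (hY : IsSurjectiveSubmersion IY IM πY)

/-- The identification of `(X × N) ×_{M × N} (Y × N)` with `(X ×_M Y) × N`, that is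
`((x, n), (y, n)) ↦ ((x, y), n)`. -/
def FibProd.distrib (z : FibProd (hX.prodId (N := N) (IN := IN)) (hY.prodId (N := N) (IN := IN))) :
    FibProd hX hY × N :=
  (FibProd.mk hX hY z.fst.1 z.snd.1 (congrArg Prod.fst z.comm), z.fst.2)

theorem FibProd.contMDiff_distrib :
    ContMDiff (FibProd.model (IX.prod IN) (hY.prodId (N := N) (IN := IN)))
      ((FibProd.model IX hY).prod IN) ∞ (FibProd.distrib N IN hX hY) :=
  (FibProd.contMDiff_mk (_root_.contMDiff_fst.comp FibProd.contMDiff_fst)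
    (_root_.contMDiff_fst.comp FibProd.contMDiff_snd) _).prodMk
    (_root_.contMDiff_snd.comp FibProd.contMDiff_fst)

end

end CupProduct

end

/-!
Write `δ(R)` for the trivial bundle gerbe of a line bundle `R`. For a single line bundle `K`, the
fibre of `(K^g)* ⊗ K^f` at `((x₁, y₁, ν), (x₂, y₂, ν))` is `(K_ν^g)* ⊗ K_ν^f`, and the fibre of
`δ(K^h)` there is `K_ν^h₂ ⊗ (K_ν^h₁)*`, where `hᵢ = h (xᵢ, yᵢ, ν)`. A unit vector `k` of `K_ν` gives
the unit vectors `(k^g)* ⊗ k^f` and `k^h₂ ⊗ (k^h₁)*`. Replacing `k` by `c k` with `|c| = 1`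
multiplies them by `c^(f - g)` and `c^(h₂ - h₁)`; these factors agree by hypothesis, so the
isometry that takes one unit vector to the other does not depend on `k`
(`HermLine.powDualMap_tmul`). It is smooth because it takes frames induced by a frame of `K` to
frames induced by that frame, and it respects the multiplications because powers of `k` are
multiplied by adding exponents and contracted by `⟪k, k⟫ = 1` (`HermLine.powDualMap_powMul`). This
is `cupProductGerbe_dual_product_isTrivialisedBy`.

Trivialisations are compatible with reduced products: from `P* ⊗ Q ≅ δ(R)` and
`P'* ⊗ Q' ≅ δ(R')` follows `(P ⊗_red P')* ⊗ (Q ⊗_red Q') ≅ δ(R ⊗ R')`, by exchanging the inner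
factors of the tensor products. Induction over the number of factors
(`BundleGerbe.IsTrivialisedBy.dual_product_redProdFin`) gives the second claim.

The hypothesis is symmetric under the exchange of `(X, g)` and `(Y, f)` if `h` is replaced by `-h`,
so the first claim is an instance of the second.
-/

noncomputable section

/-! ### Isometries of hermitian lines -/

namespace HermLine

theorem inner_self_of_norm_one {L : HermLine.{w}} {x : L} (hx : ‖x‖ = 1) : ⟪x, x⟫_ℂ = 1 := by
  rw [inner_self_eq_norm_sq_to_K, hx]
  simp

/-- Compatibility of isometries with multiplications can be checked on one pair of unit vectors. -/
theorem map_mul_of_unit {A B C A' B' C' : HermLine.{w}} {m : A.tensor B ≃ₗᵢ[ℂ] C}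
    {m' : A'.tensor B' ≃ₗᵢ[ℂ] C'} {α : A ≃ₗᵢ[ℂ] A'} {β : B ≃ₗᵢ[ℂ] B'} {γ : C ≃ₗᵢ[ℂ] C'}
    {a : A} {b : B} (ha : ‖a‖ = 1) (hb : ‖b‖ = 1)
    (h : γ (m (tmul a b)) = m' (tmul (α a) (β b))) (x : A) (y : B) :
    γ (m (tmul x y)) = m' (tmul (α x) (β y)) := by
  rw [eq_inner_smul ha x, eq_inner_smul hb y]
  simp only [map_smul, smul_tmul_smul]
  rw [h]

/-- The isometry `(A ⊗ A')* ⊗ (B ⊗ B') → (A* ⊗ B) ⊗ (A'* ⊗ B')` that exchanges the inner factors. -/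
def dualInterchange (A A' B B' : HermLine.{w}) :
    (A.tensor A').dual.tensor (B.tensor B') ≃ₗᵢ[ℂ]
      (A.dual.tensor B).tensor (A'.dual.tensor B') :=
  isoOfUnit
    (tmul (covec (tmul A.exists_unit.choose A'.exists_unit.choose))
      (tmul B.exists_unit.choose B'.exists_unit.choose))
    (by simp [A.exists_unit.choose_spec, B.exists_unit.choose_spec, A'.exists_unit.choose_spec,
      B'.exists_unit.choose_spec])
    (tmul (tmul (covec A.exists_unit.choose) B.exists_unit.choose)
      (tmul (covec A'.exists_unit.choose) B'.exists_unit.choose))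
    (by simp [A.exists_unit.choose_spec, B.exists_unit.choose_spec, A'.exists_unit.choose_spec,
      B'.exists_unit.choose_spec])

theorem dualInterchange_tmul {A A' B B' : HermLine.{w}} (a : A) (a' : A') (b : B) (b' : B') :
    dualInterchange A A' B B' (tmul (covec (tmul a a')) (tmul b b')) =
      tmul (tmul (covec a) b) (tmul (covec a') b') := by
  conv_rhs => rw [eq_inner_smul A.exists_unit.choose_spec a,
    eq_inner_smul B.exists_unit.choose_spec b, eq_inner_smul A'.exists_unit.choose_spec a',
    eq_inner_smul B'.exists_unit.choose_spec b', covec_smul, covec_smul, inner_conj_symm,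
    inner_conj_symm, smul_tmul_smul, smul_tmul_smul, smul_tmul_smul]
  simp only [dualInterchange, isoOfUnit_apply, inner_tmul, inner_covec]
  congr 1
  ring

theorem dualInterchange_tensorMul {A B C A' B' C' D E F D' E' F' : HermLine.{w}}
    (m : A.tensor B ≃ₗᵢ[ℂ] C) (m' : A'.tensor B' ≃ₗᵢ[ℂ] C') (k : D.tensor E ≃ₗᵢ[ℂ] F)
    (k' : D'.tensor E' ≃ₗᵢ[ℂ] F') (u : (A.tensor A').dual.tensor (D.tensor D'))
    (v : (B.tensor B').dual.tensor (E.tensor E')) :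
    dualInterchange C C' F F' (tensorMul (dualMul (tensorMul m m')) (tensorMul k k') (tmul u v)) =
      tensorMul (tensorMul (dualMul m) k) (tensorMul (dualMul m') k')
        (tmul (dualInterchange A A' D D' u) (dualInterchange B B' E E' v)) := by
  obtain ⟨a, ha⟩ := A.exists_unit
  obtain ⟨b, hb⟩ := B.exists_unit
  obtain ⟨a', ha'⟩ := A'.exists_unit
  obtain ⟨b', hb'⟩ := B'.exists_unit
  obtain ⟨d, hd⟩ := D.exists_unit
  obtain ⟨e, he⟩ := E.exists_unit
  obtain ⟨d', hd'⟩ := D'.exists_unit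
  obtain ⟨e', he'⟩ := E'.exists_unit
  refine map_mul_of_unit (a := tmul (covec (tmul a a')) (tmul d d'))
    (b := tmul (covec (tmul b b')) (tmul e e')) ?_ ?_ ?_ u v
  · simp only [norm_tmul, norm_covec, ha, ha', hd, hd', one_mul]
  · simp only [norm_tmul, norm_covec, hb, hb', he, he', one_mul]
  · simp only [tensorMul_tmul, dualMul_covec, dualInterchange_tmul]

/-- The isometry `(A ⊗ B*) ⊗ (A' ⊗ B'*) → (A ⊗ A') ⊗ (B ⊗ B')*` that exchanges the inner factors. -/
def interchangeDual (A B A' B' : HermLine.{w}) :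
    (A.tensor B.dual).tensor (A'.tensor B'.dual) ≃ₗᵢ[ℂ]
      (A.tensor A').tensor (B.tensor B').dual :=
  isoOfUnit
    (tmul (tmul A.exists_unit.choose (covec B.exists_unit.choose))
      (tmul A'.exists_unit.choose (covec B'.exists_unit.choose)))
    (by simp [A.exists_unit.choose_spec, B.exists_unit.choose_spec, A'.exists_unit.choose_spec,
      B'.exists_unit.choose_spec])
    (tmul (tmul A.exists_unit.choose A'.exists_unit.choose)
      (covec (tmul B.exists_unit.choose B'.exists_unit.choose)))
    (by simp [A.exists_unit.choose_spec, B.exists_unit.choose_spec, A'.exists_unit.choose_spec,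
      B'.exists_unit.choose_spec])

theorem interchangeDual_tmul {A B A' B' : HermLine.{w}} (a : A) (b : B) (a' : A') (b' : B') :
    interchangeDual A B A' B' (tmul (tmul a (covec b)) (tmul a' (covec b'))) =
      tmul (tmul a a') (covec (tmul b b')) := by
  conv_rhs => rw [eq_inner_smul A.exists_unit.choose_spec a,
    eq_inner_smul B.exists_unit.choose_spec b, eq_inner_smul A'.exists_unit.choose_spec a',
    eq_inner_smul B'.exists_unit.choose_spec b', smul_tmul_smul, smul_tmul_smul, covec_smul,
    map_mul, inner_conj_symm, inner_conj_symm, smul_tmul_smul]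
  simp only [interchangeDual, isoOfUnit_apply, inner_tmul, inner_covec]
  congr 1
  ring

theorem interchangeDual_contract (A B C A' B' C' : HermLine.{w})
    (u : (B.tensor A.dual).tensor (B'.tensor A'.dual))
    (v : (C.tensor B.dual).tensor (C'.tensor B'.dual)) :
    interchangeDual C A C' A' (tensorMul (contract A B C) (contract A' B' C') (tmul u v)) =
      contract (A.tensor A') (B.tensor B') (C.tensor C')
        (tmul (interchangeDual B A B' A' u) (interchangeDual C B C' B' v)) := by
  obtain ⟨a, ha⟩ := A.exists_unit
  obtain ⟨b, hb⟩ := B.exists_unit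
  obtain ⟨c, hc⟩ := C.exists_unit
  obtain ⟨a', ha'⟩ := A'.exists_unit
  obtain ⟨b', hb'⟩ := B'.exists_unit
  obtain ⟨c', hc'⟩ := C'.exists_unit
  refine map_mul_of_unit (a := tmul (tmul b (covec a)) (tmul b' (covec a')))
    (b := tmul (tmul c (covec b)) (tmul c' (covec b'))) ?_ ?_ ?_ u v
  · simp only [norm_tmul, norm_covec, ha, ha', hb, hb', one_mul]
  · simp only [norm_tmul, norm_covec, hb, hb', hc, hc', one_mul]
  · simp only [tensorMul_tmul, contract_tmul, interchangeDual_tmul, eval_covec, inner_tmul,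
      inner_self_of_norm_one hb, inner_self_of_norm_one hb', one_smul, mul_one]

/-- The tensor product of two isometries of hermitian lines. -/
def tensorMap {A B A' B' : HermLine.{w}} (φ : A ≃ₗᵢ[ℂ] B) (φ' : A' ≃ₗᵢ[ℂ] B') :
    A.tensor A' ≃ₗᵢ[ℂ] B.tensor B' :=
  isoOfUnit (tmul A.exists_unit.choose A'.exists_unit.choose)
    (by simp [A.exists_unit.choose_spec, A'.exists_unit.choose_spec])
    (tmul (φ A.exists_unit.choose) (φ' A'.exists_unit.choose))
    (by simp [A.exists_unit.choose_spec, A'.exists_unit.choose_spec])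

theorem tensorMap_tmul {A B A' B' : HermLine.{w}} (φ : A ≃ₗᵢ[ℂ] B) (φ' : A' ≃ₗᵢ[ℂ] B') (a : A)
    (a' : A') : tensorMap φ φ' (tmul a a') = tmul (φ a) (φ' a') := by
  conv_rhs => rw [eq_inner_smul A.exists_unit.choose_spec a,
    eq_inner_smul A'.exists_unit.choose_spec a', map_smul, map_smul, smul_tmul_smul]
  simp only [tensorMap, isoOfUnit_apply, inner_tmul]

theorem tensorMap_tensorMul {A B C A' B' C' D E F D' E' F' : HermLine.{w}}
    {m : A.tensor B ≃ₗᵢ[ℂ] C} {m' : A'.tensor B' ≃ₗᵢ[ℂ] C'} {k : D.tensor E ≃ₗᵢ[ℂ] F}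
    {k' : D'.tensor E' ≃ₗᵢ[ℂ] F'} {α : A ≃ₗᵢ[ℂ] D} {β : B ≃ₗᵢ[ℂ] E} {γ : C ≃ₗᵢ[ℂ] F}
    {α' : A' ≃ₗᵢ[ℂ] D'} {β' : B' ≃ₗᵢ[ℂ] E'} {γ' : C' ≃ₗᵢ[ℂ] F'}
    (h : ∀ a b, γ (m (tmul a b)) = k (tmul (α a) (β b)))
    (h' : ∀ a b, γ' (m' (tmul a b)) = k' (tmul (α' a) (β' b))) (u : A.tensor A')
    (v : B.tensor B') :
    tensorMap γ γ' (tensorMul m m' (tmul u v)) =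
      tensorMul k k' (tmul (tensorMap α α' u) (tensorMap β β' v)) := by
  obtain ⟨a, ha⟩ := A.exists_unit
  obtain ⟨b, hb⟩ := B.exists_unit
  obtain ⟨a', ha'⟩ := A'.exists_unit
  obtain ⟨b', hb'⟩ := B'.exists_unit
  refine map_mul_of_unit (a := tmul a a') (b := tmul b b') ?_ ?_ ?_ u v
  · rw [norm_tmul, ha, ha', one_mul]
  · rw [norm_tmul, hb, hb', one_mul]
  · rw [tensorMul_tmul, tensorMap_tmul, tensorMap_tmul, tensorMap_tmul, tensorMul_tmul, h, h']

/-- The isometry `(L^g)* ⊗ L'^f → L''^h₂ ⊗ (L^h₁)*`, where the lines `L`, `L'` and `L''` are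
identified through `e` and `e'`. It is independent of the chosen unit vector if
`f - g = h₂ - h₁`. -/
def powDualMap {L L' L'' : HermLine.{w}} (e : L ≃ₗᵢ[ℂ] L') (e' : L ≃ₗᵢ[ℂ] L'')
    (g f h₂ h₁ : ℤ) :
    (L.zpow g).dual.tensor (L'.zpow f) ≃ₗᵢ[ℂ] (L''.zpow h₂).tensor (L.zpow h₁).dual :=
  isoOfUnit
    (tmul (covec (zpowVec L.exists_unit.choose g)) (zpowVec (e L.exists_unit.choose) f))
    (by
      rw [norm_tmul, norm_covec, norm_zpowVec L.exists_unit.choose_spec,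
        norm_zpowVec (by rw [e.norm_map, L.exists_unit.choose_spec]), one_mul])
    (tmul (zpowVec (e' L.exists_unit.choose) h₂) (covec (zpowVec L.exists_unit.choose h₁)))
    (by
      rw [norm_tmul, norm_covec, norm_zpowVec L.exists_unit.choose_spec,
        norm_zpowVec (by rw [e'.norm_map, L.exists_unit.choose_spec]), one_mul])

theorem powDualMap_tmul {L L' L'' : HermLine.{w}} (e : L ≃ₗᵢ[ℂ] L') (e' : L ≃ₗᵢ[ℂ] L'')
    {g f h₂ h₁ : ℤ} (h : f - g = h₂ - h₁) {x : L} {x' : L'} {x'' : L''} (hx : ‖x‖ = 1)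
    (he : e x = x') (he' : e' x = x'') :
    powDualMap e e' g f h₂ h₁ (tmul (covec (zpowVec x g)) (zpowVec x' f)) =
      tmul (zpowVec x'' h₂) (covec (zpowVec x h₁)) := by
  subst he he'
  have hu := L.exists_unit.choose_spec
  have hu' : ‖e L.exists_unit.choose‖ = 1 := by rw [e.norm_map, hu]
  have hu'' : ‖e' L.exists_unit.choose‖ = 1 := by rw [e'.norm_map, hu]
  have hx' : ‖e x‖ = 1 := by rw [e.norm_map, hx]
  have hx'' : ‖e' x‖ = 1 := by rw [e'.norm_map, hx]
  have hne : ⟪L.exists_unit.choose, x⟫_ℂ ≠ 0 := by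
    intro h0
    have := norm_inner_unit hu hx
    rw [h0, norm_zero] at this
    exact zero_ne_one this
  rw [zpowVec_eq hu hx h₁, zpowVec_eq hu'' hx'' h₂, covec_smul, smul_tmul_smul]
  simp only [powDualMap, isoOfUnit_apply, inner_tmul, inner_covec, inner_zpowVec hx hu,
    inner_zpowVec hu' hx', LinearIsometryEquiv.inner_map_map]
  rw [map_zpow₀, inner_conj_symm, inner_unit_inv hu hx, inv_zpow, inv_zpow, ← zpow_neg, ← zpow_neg,
    ← zpow_add₀ hne, ← zpow_add₀ hne]
  congr 2
  omega

/-- The isometries `powDualMap` over `(1, 2)`, `(2, 3)` and `(1, 3)` take the multiplication of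
powers to the contraction, if every identification of lines preserves a chosen unit vector. -/
theorem powDualMap_powMul {L₁ L₁' L₂ L₂' L₃ : HermLine.{w}}
    {e₁ : L₁ ≃ₗᵢ[ℂ] L₁'} {e₂ : L₂ ≃ₗᵢ[ℂ] L₂'} {e₁₂ : L₁ ≃ₗᵢ[ℂ] L₂} {e₁₂' : L₁' ≃ₗᵢ[ℂ] L₂'}
    {e₂₃ : L₂ ≃ₗᵢ[ℂ] L₃} {e₁₃ : L₁ ≃ₗᵢ[ℂ] L₃}
    {x₁ : L₁} {x₁' : L₁'} {x₂ : L₂} {x₂' : L₂'} {x₃ : L₃} (hx₁ : ‖x₁‖ = 1)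
    (h₁ : e₁ x₁ = x₁') (h₂ : e₂ x₂ = x₂') (h₁₂ : e₁₂ x₁ = x₂) (h₁₂' : e₁₂' x₁' = x₂')
    (h₂₃ : e₂₃ x₂ = x₃) (h₁₃ : e₁₃ x₁ = x₃) {f₁₂ f₂₃ f₁₃ g₁₂ g₂₃ g₁₃ k₁ k₂ k₃ : ℤ}
    (hf : f₁₂ + f₂₃ = f₁₃) (hg : g₁₂ + g₂₃ = g₁₃) (hk₁₂ : f₁₂ - g₁₂ = k₂ - k₁)
    (hk₂₃ : f₂₃ - g₂₃ = k₃ - k₂) (hk₁₃ : f₁₃ - g₁₃ = k₃ - k₁)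
    (u : (L₁.zpow g₁₂).dual.tensor (L₁'.zpow f₁₂)) (v : (L₂.zpow g₂₃).dual.tensor (L₂'.zpow f₂₃)) :
    powDualMap e₁ e₁₃ g₁₃ f₁₃ k₃ k₁
        (tensorMul (dualMul (powMul e₁₂ g₁₂ g₂₃ g₁₃)) (powMul e₁₂' f₁₂ f₂₃ f₁₃) (tmul u v)) =
      contract (L₁.zpow k₁) (L₂.zpow k₂) (L₃.zpow k₃)
        (tmul (powDualMap e₁ e₁₂ g₁₂ f₁₂ k₂ k₁ u) (powDualMap e₂ e₂₃ g₂₃ f₂₃ k₃ k₂ v)) := by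
  have hx₁' : ‖x₁'‖ = 1 := by rw [← h₁, e₁.norm_map, hx₁]
  have hx₂ : ‖x₂‖ = 1 := by rw [← h₁₂, e₁₂.norm_map, hx₁]
  have hx₂' : ‖x₂'‖ = 1 := by rw [← h₂, e₂.norm_map, hx₂]
  refine map_mul_of_unit (a := tmul (covec (zpowVec x₁ g₁₂)) (zpowVec x₁' f₁₂))
    (b := tmul (covec (zpowVec x₂ g₂₃)) (zpowVec x₂' f₂₃)) ?_ ?_ ?_ u v
  · rw [norm_tmul, norm_covec, norm_zpowVec hx₁, norm_zpowVec hx₁', one_mul]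
  · rw [norm_tmul, norm_covec, norm_zpowVec hx₂, norm_zpowVec hx₂', one_mul]
  · rw [powDualMap_tmul e₁ e₁₂ hk₁₂ hx₁ h₁ h₁₂, powDualMap_tmul e₂ e₂₃ hk₂₃ hx₂ h₂ h₂₃,
      contract_tmul, eval_covec, inner_self_of_norm_one (norm_zpowVec hx₂ k₂), one_smul,
      tensorMul_tmul, dualMul_covec]
    subst h₁₂ h₁₂'
    rw [powMul_tmul e₁₂ hg hx₁, powMul_tmul e₁₂' hf hx₁', powDualMap_tmul e₁ e₁₃ hk₁₃ hx₁ h₁ h₁₃]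

end HermLine

/-! ### Isomorphisms of hermitian line bundles -/

namespace HermitianLineBundle

variable {E H B : Type*} [NormedAddCommGroup E] [NormedSpace ℝ E] [TopologicalSpace H]
  [TopologicalSpace B] [ChartedSpace H B] {I : ModelWithCorners ℝ E H}
  {E' H' B' : Type*} [NormedAddCommGroup E'] [NormedSpace ℝ E'] [TopologicalSpace H']
  [TopologicalSpace B'] [ChartedSpace H' B'] {I' : ModelWithCorners ℝ E' H'}

/-- A fibrewise isometry that takes a frame to a frame near each point is smooth. -/
theorem isSmooth_of_map_sec {L L' : HermitianLineBundle.{w} I B}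
    {φ : ∀ b, L.fiber b ≃ₗᵢ[ℂ] L'.fiber b}
    (h : ∀ b, ∃ s ∈ L.frames, ∃ t ∈ L'.frames, b ∈ s.dom ∧ b ∈ t.dom ∧
      ∀ c ∈ s.dom, c ∈ t.dom → φ c (s.sec c) = t.sec c) : IsSmooth L L' φ := by
  apply isSmooth_of_exists
  intro b
  obtain ⟨s, hs, t, ht, hbs, hbt, hst⟩ := h b
  refine ⟨s, hs, t, ht, hbs, hbt,
    (contMDiffAt_const (c := (1 : ℂ))).congr_of_eventuallyEq ?_⟩
  filter_upwards [s.isOpen_dom.mem_nhds hbs, t.isOpen_dom.mem_nhds hbt] with c hcs hct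
  rw [hst c hcs hct, HermLine.inner_self_of_norm_one (t.norm_sec c hct)]

/-- The composition of isomorphisms of line bundles. -/
def Iso.trans {L L' L'' : HermitianLineBundle.{w} I B} (φ : L.Iso L') (ψ : L'.Iso L'') :
    L.Iso L'' where
  equiv b := (φ.equiv b).trans (ψ.equiv b)
  smooth := by
    apply isSmooth_of_exists
    intro b
    obtain ⟨s, hs, hbs⟩ := L.cover b
    obtain ⟨t, ht, hbt⟩ := L'.cover b
    obtain ⟨u, hu, hbu⟩ := L''.cover b
    refine ⟨s, hs, u, hu, hbs, hbu, ((φ.smooth s hs t ht b hbs hbt).mul_complex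
      (ψ.smooth t ht u hu b hbt hbu)).congr_of_eventuallyEq ?_⟩
    filter_upwards [t.isOpen_dom.mem_nhds hbt] with c hct
    rw [LinearIsometryEquiv.trans_apply]
    conv_lhs => rw [HermLine.eq_inner_smul (t.norm_sec c hct) (φ.equiv c (s.sec c)), map_smul,
      inner_smul_right]

/-- The tensor product of isomorphisms of line bundles. -/
def Iso.tensor {L₁ L₂ L₁' L₂' : HermitianLineBundle.{w} I B} (φ : L₁.Iso L₂) (φ' : L₁'.Iso L₂') :
    (L₁.tensor L₁').Iso (L₂.tensor L₂') where
  equiv b := HermLine.tensorMap (φ.equiv b) (φ'.equiv b)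
  smooth := by
    rintro _ ⟨s, hs, s', hs', rfl⟩ _ ⟨t, ht, t', ht', rfl⟩ b hb hb'
    refine ((φ.smooth s hs t ht b hb.1 hb'.1).mul_complex
      (φ'.smooth s' hs' t' ht' b hb.2 hb'.2)).congr_of_eventuallyEq
        (Filter.Eventually.of_forall fun c => ?_)
    exact (congrArg _ (HermLine.tensorMap_tmul _ _ _ _)).trans (HermLine.inner_tmul _ _ _ _)

/-- Both sides have definitionally equal fibres, and the same frames. -/
theorem pullback_tensor (L L' : HermitianLineBundle.{w} I B) (φ : B' → B)
    (hφ : ContMDiff I' I ∞ φ) :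
    (L.tensor L').pullback φ hφ = (L.pullback φ hφ).tensor (L'.pullback φ hφ) := by
  unfold pullback tensor
  congr 1
  ext u
  constructor
  · rintro ⟨_, ⟨s, hs, t, ht, rfl⟩, rfl⟩
    exact ⟨_, ⟨s, hs, rfl⟩, _, ⟨t, ht, rfl⟩, rfl⟩
  · rintro ⟨_, ⟨s, hs, rfl⟩, _, ⟨t, ht, rfl⟩, rfl⟩
    exact ⟨_, ⟨s, hs, t, ht, rfl⟩, rfl⟩

theorem pullback_tensorFin (φ : B' → B) (hφ : ContMDiff I' I ∞ φ) :
    ∀ (n : ℕ) (L : Fin (n + 1) → HermitianLineBundle.{w} I B),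
      (tensorFin n L).pullback φ hφ = tensorFin n fun i => (L i).pullback φ hφ
  | 0, _ => rfl
  | n + 1, L => by
    rw [tensorFin, pullback_tensor, pullback_tensorFin φ hφ n]
    rfl

end HermitianLineBundle

/-! ### Reduced products of trivialised bundle gerbes -/

section

variable {EM HM M : Type*} [NormedAddCommGroup EM] [NormedSpace ℝ EM] [TopologicalSpace HM]
  [TopologicalSpace M] [ChartedSpace HM M] {IM : ModelWithCorners ℝ EM HM}
  {EX HX X : Type*} [NormedAddCommGroup EX] [NormedSpace ℝ EX] [TopologicalSpace HX]
  [TopologicalSpace X] [ChartedSpace HX X] {IX : ModelWithCorners ℝ EX HX}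
  [IX.Boundaryless] [IsManifold IX ∞ X]
  {EY HY Y : Type*} [NormedAddCommGroup EY] [NormedSpace ℝ EY] [TopologicalSpace HY]
  [TopologicalSpace Y] [ChartedSpace HY Y] {IY : ModelWithCorners ℝ EY HY}
  [IY.Boundaryless] [IsManifold IY ∞ Y]
  {πX : X → M} {πY : Y → M}
  {hX : IsSurjectiveSubmersion IX IM πX} {hY : IsSurjectiveSubmersion IY IM πY}

/- Kept folded, these make unification compare the hermitian lines they are applied to rather than
the chosen unit vectors in their definitions. -/
attribute [local irreducible] HermLine.tensor HermLine.dual HermLine.tmul HermLine.contract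
  HermLine.tensorMul HermLine.dualMul HermLine.interchangeDual HermLine.dualInterchange
  HermLine.powMul HermLine.powDualMap HermLine.zpow HermLine.zpowVec

namespace BundleGerbe

/-- The composition of isomorphisms of bundle gerbes. -/
def Iso.trans {P Q R : BundleGerbe.{w} hY} (φ : P.Iso Q) (ψ : Q.Iso R) : P.Iso R where
  line := φ.line.trans ψ.line
  map_prod z a b := by
    change ψ.line.equiv _ (φ.line.equiv _ (P.prod z a b)) = _
    rw [φ.map_prod, ψ.map_prod]
    rfl

/-- The reduced product of isomorphisms of bundle gerbes. -/
def Iso.redProd {P Q P' Q' : BundleGerbe.{w} hY} (φ : P.Iso Q) (φ' : P'.Iso Q') :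
    (P.redProd P').Iso (Q.redProd Q') where
  line := φ.line.tensor φ'.line
  map_prod z := HermLine.tensorMap_tensorMul (φ.map_prod z) (φ'.map_prod z)

/-- `(P ⊗_red P')* ⊗ (Q ⊗_red Q') ≅ (P* ⊗ Q) ⊗_red (P'* ⊗ Q')`. -/
def dualProductRedProdIso (P P' : BundleGerbe.{w} hX) (Q Q' : BundleGerbe.{w} hY) :
    ((P.redProd P').dual.product (Q.redProd Q')).Iso
      ((P.dual.product Q).redProd (P'.dual.product Q')) where
  line :=
    { equiv := fun z => HermLine.dualInterchange
        (P.line.fiber (sqMap FibProd.fst (fun _ => rfl) z))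
        (P'.line.fiber (sqMap FibProd.fst (fun _ => rfl) z))
        (Q.line.fiber (sqMap FibProd.snd (fun p => p.comm.symm) z))
        (Q'.line.fiber (sqMap FibProd.snd (fun p => p.comm.symm) z))
      smooth := by
        apply HermitianLineBundle.isSmooth_of_map_sec
        intro z
        obtain ⟨s, hs, hzs⟩ := P.line.cover (sqMap FibProd.fst (fun _ => rfl) z)
        obtain ⟨s', hs', hzs'⟩ := P'.line.cover (sqMap FibProd.fst (fun _ => rfl) z)
        obtain ⟨t, ht, hzt⟩ := Q.line.cover (sqMap FibProd.snd (fun p => p.comm.symm) z)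
        obtain ⟨t', ht', hzt'⟩ := Q'.line.cover (sqMap FibProd.snd (fun p => p.comm.symm) z)
        exact ⟨_, ⟨_, ⟨_, ⟨_, ⟨s, hs, s', hs', rfl⟩, rfl⟩, rfl⟩,
            _, ⟨_, ⟨t, ht, t', ht', rfl⟩, rfl⟩, rfl⟩,
          _, ⟨_, ⟨_, ⟨_, ⟨s, hs, rfl⟩, rfl⟩, _, ⟨t, ht, rfl⟩, rfl⟩,
            _, ⟨_, ⟨_, ⟨s', hs', rfl⟩, rfl⟩, _, ⟨t', ht', rfl⟩, rfl⟩, rfl⟩,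
          ⟨⟨hzs, hzs'⟩, ⟨hzt, hzt'⟩⟩, ⟨⟨hzs, hzt⟩, ⟨hzs', hzt'⟩⟩,
          fun c _ _ => HermLine.dualInterchange_tmul (s.sec _) (s'.sec _) (t.sec _) (t'.sec _)⟩ }
  map_prod z := HermLine.dualInterchange_tensorMul
    (P.mul (cubeMap FibProd.fst (fun _ => rfl) z)) (P'.mul (cubeMap FibProd.fst (fun _ => rfl) z))
    (Q.mul (cubeMap FibProd.snd (fun p => p.comm.symm) z))
    (Q'.mul (cubeMap FibProd.snd (fun p => p.comm.symm) z))

/-- `δ(R) ⊗_red δ(R') ≅ δ(R ⊗ R')`. -/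
def trivialRedProdIso (R R' : HermitianLineBundle.{w} IY Y) :
    ((trivial hY R).redProd (trivial hY R')).Iso (trivial hY (R.tensor R')) where
  line :=
    { equiv := fun z => HermLine.interchangeDual (R.fiber z.snd) (R.fiber z.fst) (R'.fiber z.snd)
        (R'.fiber z.fst)
      smooth := by
        apply HermitianLineBundle.isSmooth_of_map_sec
        intro z
        obtain ⟨s, hs, hzs⟩ := R.cover z.snd
        obtain ⟨s', hs', hzs'⟩ := R'.cover z.snd
        obtain ⟨t, ht, hzt⟩ := R.cover z.fst
        obtain ⟨t', ht', hzt'⟩ := R'.cover z.fst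
        exact ⟨_, ⟨_, ⟨_, ⟨s, hs, rfl⟩, _, ⟨_, ⟨t, ht, rfl⟩, rfl⟩, rfl⟩,
            _, ⟨_, ⟨s', hs', rfl⟩, _, ⟨_, ⟨t', ht', rfl⟩, rfl⟩, rfl⟩, rfl⟩,
          _, ⟨_, ⟨_, ⟨s, hs, s', hs', rfl⟩, rfl⟩, _, ⟨_, ⟨_, ⟨t, ht, t', ht', rfl⟩, rfl⟩, rfl⟩,
            rfl⟩,
          ⟨⟨hzs, hzt⟩, ⟨hzs', hzt'⟩⟩, ⟨⟨hzs, hzs'⟩, ⟨hzt, hzt'⟩⟩,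
          fun c _ _ => HermLine.interchangeDual_tmul (s.sec _) (t.sec _) (s'.sec _) (t'.sec _)⟩ }
  map_prod z := HermLine.interchangeDual_contract (R.fiber z.fst.fst) (R.fiber z.fst.snd)
    (R.fiber z.snd) (R'.fiber z.fst.fst) (R'.fiber z.fst.snd) (R'.fiber z.snd)

/-- If `P* ⊗ Q ≅ δ(R)` and `P'* ⊗ Q' ≅ δ(R')`, then
`(P ⊗_red P')* ⊗ (Q ⊗_red Q') ≅ δ(R ⊗ R')`. -/
theorem IsTrivialisedBy.dual_product_redProd {P P' : BundleGerbe.{w} hX} {Q Q' : BundleGerbe.{w} hY}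
    {R R' : HermitianLineBundle.{w} (FibProd.model IX hY) (FibProd hX hY)}
    (h : (P.dual.product Q).IsTrivialisedBy R) (h' : (P'.dual.product Q').IsTrivialisedBy R') :
    ((P.redProd P').dual.product (Q.redProd Q')).IsTrivialisedBy (R.tensor R') := by
  obtain ⟨φ⟩ := h
  obtain ⟨φ'⟩ := h'
  exact ⟨((dualProductRedProdIso P P' Q Q').trans (φ.redProd φ')).trans (trivialRedProdIso R R')⟩

theorem IsTrivialisedBy.dual_product_redProdFin :
    ∀ (n : ℕ) {P : Fin (n + 1) → BundleGerbe.{w} hX} {Q : Fin (n + 1) → BundleGerbe.{w} hY}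
      {R : Fin (n + 1) → HermitianLineBundle.{w} (FibProd.model IX hY) (FibProd hX hY)},
      (∀ i, ((P i).dual.product (Q i)).IsTrivialisedBy (R i)) →
      ((redProdFin n P).dual.product (redProdFin n Q)).IsTrivialisedBy
        (HermitianLineBundle.tensorFin n R)
  | 0, _, _, _, h => h 0
  | n + 1, _, _, _, h =>
    (dual_product_redProdFin n fun i => h i.castSucc).dual_product_redProd (h (Fin.last (n + 1)))

end BundleGerbe

/-! ### Trivialisations of cup product bundle gerbes -/

/-- The exchange of factors `Y ×_M X → X ×_M Y`. -/
def FibProd.swap (z : FibProd hY hX) : FibProd hX hY :=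
  FibProd.mk hX hY z.snd z.fst z.comm.symm

omit [IX.Boundaryless] [IsManifold IX ∞ X] [IY.Boundaryless] [IsManifold IY ∞ Y] in
theorem FibProd.continuous_swap : Continuous (FibProd.swap : FibProd hY hX → FibProd hX hY) :=
  (FibProd.continuous_snd.prodMk FibProd.continuous_fst).subtype_mk _

variable [IsManifold IM ∞ M]
  {EN HN N : Type*} [NormedAddCommGroup EN] [NormedSpace ℝ EN] [TopologicalSpace HN]
  [TopologicalSpace N] [ChartedSpace HN N] {IN : ModelWithCorners ℝ EN HN}
  [IN.Boundaryless] [IsManifold IN ∞ N]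

/-- On the fibre over `(x₁, y₁, ν), (x₂, y₂, ν)` the isomorphism takes `(k^g)* ⊗ k^f` to
`k^(h (x₂, y₂, ν)) ⊗ (k^(h (x₁, y₁, ν)))*` for each unit vector `k` of `K_ν`. -/
theorem cupProductGerbe_dual_product_isTrivialisedBy (K : HermitianLineBundle.{w} IN N)
    {f : LocallyConstant (Fib2 hY) ℤ} (hf : IsCocycle hY f)
    {g : LocallyConstant (Fib2 hX) ℤ} (hg : IsCocycle hX g)
    {h : LocallyConstant (FibProd hX hY × N) ℤ}
    (hfgh : ∀ (x₁ x₂ : X) (y₁ y₂ : Y) (ν : N) (h₁ : πX x₁ = πY y₁)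
      (h₂ : πX x₂ = πY y₂) (hx : πX x₁ = πX x₂) (hy : πY y₁ = πY y₂),
      f (Fib2.mk hY y₁ y₂ hy) - g (Fib2.mk hX x₁ x₂ hx) =
        h (FibProd.mk hX hY x₂ y₂ h₂, ν) - h (FibProd.mk hX hY x₁ y₁ h₁, ν)) :
    ((cupProductGerbe K g hg).dual.product (cupProductGerbe K f hf)).IsTrivialisedBy
      (((K.pullback (Prod.snd : FibProd hX hY × N → N) contMDiff_snd).pow h).pullback
        (FibProd.distrib N IN hX hY) (FibProd.contMDiff_distrib N IN hX hY)) := by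
  -- The base points in `N` of the factors agree, but only propositionally.
  have hν (p : FibProd (hX.prodId (N := N) (IN := IN)) (hY.prodId (N := N) (IN := IN))) :
      p.fst.2 = p.snd.2 := (congrArg Prod.snd p.comm :)
  have hν₁ (z : Fib2 ((hX.prodId (N := N) (IN := IN)).fibProd (hY.prodId (N := N) (IN := IN)))) :
      z.fst.fst.2 = z.snd.fst.2 := (congrArg Prod.snd z.comm :)
  have hν₂ (z : Fib2 ((hX.prodId (N := N) (IN := IN)).fibProd (hY.prodId (N := N) (IN := IN)))) :
      z.fst.snd.2 = z.snd.snd.2 := (hν z.fst).symm.trans ((hν₁ z).trans (hν z.snd))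
  have hdeg (z : Fib2 ((hX.prodId (N := N) (IN := IN)).fibProd (hY.prodId (N := N) (IN := IN)))) :
      f.fstExt (cupProj N IN hY (sqMap FibProd.snd (fun p => p.comm.symm) z)) -
        g.fstExt (cupProj N IN hX (sqMap FibProd.fst (fun _ => rfl) z)) =
      h (FibProd.distrib N IN hX hY z.snd) - h (FibProd.distrib N IN hX hY z.fst) := by
    have h₁ : πX z.fst.fst.1 = πY z.fst.snd.1 := congrArg Prod.fst z.fst.comm
    have h₂ : πX z.snd.fst.1 = πY z.snd.snd.1 := congrArg Prod.fst z.snd.comm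
    have hx : πX z.fst.fst.1 = πX z.snd.fst.1 := congrArg Prod.fst z.comm
    refine (hfgh _ _ _ _ z.fst.fst.2 h₁ h₂ hx (h₁.symm.trans (hx.trans h₂))).trans ?_
    congr 2
    exact Prod.ext rfl (hν₁ z)
  have hf' (z : Fib3 ((hX.prodId (N := N) (IN := IN)).fibProd (hY.prodId (N := N) (IN := IN)))) :
      f.fstExt (cupProj N IN hY (sqMap FibProd.snd (fun p => p.comm.symm) (p12 _ z))) +
        f.fstExt (cupProj N IN hY (sqMap FibProd.snd (fun p => p.comm.symm) (p23 _ z))) =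
        f.fstExt (cupProj N IN hY (sqMap FibProd.snd (fun p => p.comm.symm) (p13 _ z))) :=
    hf.add_eq _ _ _ _ _
  have hg' (z : Fib3 ((hX.prodId (N := N) (IN := IN)).fibProd (hY.prodId (N := N) (IN := IN)))) :
      g.fstExt (cupProj N IN hX (sqMap FibProd.fst (fun _ => rfl) (p12 _ z))) +
        g.fstExt (cupProj N IN hX (sqMap FibProd.fst (fun _ => rfl) (p23 _ z))) =
        g.fstExt (cupProj N IN hX (sqMap FibProd.fst (fun _ => rfl) (p13 _ z))) :=
    hg.add_eq _ _ _ _ _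
  choose s hs hmem using K.cover
  -- On all fibres over the domain of `s ν` the map is given by the same formula in that frame.
  have hsec (ν : N)
      (z : Fib2 ((hX.prodId (N := N) (IN := IN)).fibProd (hY.prodId (N := N) (IN := IN))))
      (hz : z.fst.fst.2 ∈ (s ν).dom) :=
    HermLine.powDualMap_tmul (K.transport (hν z.fst)) (K.transport (hν₁ z)) (hdeg z)
      ((s ν).norm_sec _ hz) (K.transport_sec (s ν).sec _) (K.transport_sec (s ν).sec _)
  have hmul (z : Fib3 ((hX.prodId (N := N) (IN := IN)).fibProd (hY.prodId (N := N) (IN := IN)))) :=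
    HermLine.powDualMap_powMul (e₁ := K.transport (hν z.fst.fst))
      (e₂ := K.transport (hν z.fst.snd)) (e₁₂ := K.transport (hν₁ (p12 _ z)))
      (e₁₂' := K.transport (hν₂ (p12 _ z))) (e₂₃ := K.transport (hν₁ (p23 _ z)))
      (e₁₃ := K.transport (hν₁ (p13 _ z))) ((s _).norm_sec _ (hmem z.fst.fst.fst.2))
      (K.transport_sec (s _).sec _) (K.transport_sec (s _).sec _) (K.transport_sec (s _).sec _)
      (K.transport_sec (s _).sec _) (K.transport_sec (s _).sec _) (K.transport_sec (s _).sec _)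
      (hf' z) (hg' z) (hdeg (p12 _ z)) (hdeg (p23 _ z)) (hdeg (p13 _ z))
  refine ⟨⟨⟨fun z => HermLine.powDualMap (K.transport (hν z.fst)) (K.transport (hν₁ z)) _ _ _ _,
    HermitianLineBundle.isSmooth_of_map_sec fun z => ?_⟩, fun z => hmul z⟩⟩
  have hz := hmem z.fst.fst.2
  have hs := hs z.fst.fst.2
  have hz' : z.fst.snd.2 ∈ (s z.fst.fst.2).dom := hν z.fst ▸ hz
  have hz'' : z.snd.fst.2 ∈ (s z.fst.fst.2).dom := hν₁ z ▸ hz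
  refine ⟨_, ⟨_, ⟨_, ⟨_, ⟨_, ⟨_, ⟨_, hs, rfl⟩, rfl⟩, rfl⟩, rfl⟩, rfl⟩,
      _, ⟨_, ⟨_, ⟨_, ⟨_, hs, rfl⟩, rfl⟩, rfl⟩, rfl⟩, rfl⟩,
    _, ⟨_, ⟨_, ⟨_, ⟨_, ⟨_, hs, rfl⟩, rfl⟩, rfl⟩, rfl⟩,
      _, ⟨_, ⟨_, ⟨_, ⟨_, ⟨_, hs, rfl⟩, rfl⟩, rfl⟩, rfl⟩, rfl⟩, rfl⟩,
    ⟨hz, hz'⟩, ⟨hz'', hz⟩, fun c hc _ => ?_⟩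
  exact hsec _ c hc.1

end

end

theorem mainTheorem7
    {EM HM M : Type*} [NormedAddCommGroup EM] [NormedSpace ℝ EM] [TopologicalSpace HM]
    [TopologicalSpace M] [ChartedSpace HM M] {IM : ModelWithCorners ℝ EM HM}
    [IM.Boundaryless] [IsManifold IM ∞ M]
    {EX HX X : Type*} [NormedAddCommGroup EX] [NormedSpace ℝ EX] [TopologicalSpace HX]
    [TopologicalSpace X] [ChartedSpace HX X] {IX : ModelWithCorners ℝ EX HX}
    [IX.Boundaryless] [IsManifold IX ∞ X]
    {EY HY Y : Type*} [NormedAddCommGroup EY] [NormedSpace ℝ EY] [TopologicalSpace HY]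
    [TopologicalSpace Y] [ChartedSpace HY Y] {IY : ModelWithCorners ℝ EY HY}
    [IY.Boundaryless] [IsManifold IY ∞ Y]
    {EN HN N : Type*} [NormedAddCommGroup EN] [NormedSpace ℝ EN] [TopologicalSpace HN]
    [TopologicalSpace N] [ChartedSpace HN N] {IN : ModelWithCorners ℝ EN HN}
    [IN.Boundaryless] [IsManifold IN ∞ N]
    {πX : X → M} {πY : Y → M}
    (hX : IsSurjectiveSubmersion IX IM πX) (hY : IsSurjectiveSubmersion IY IM πY)
    (n : ℕ) (K : Fin (n + 1) → HermitianLineBundle.{w} IN N)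
    (f : Fin (n + 1) → LocallyConstant (Fib2 hY) ℤ) (hf : ∀ i, IsCocycle hY (f i))
    (g : Fin (n + 1) → LocallyConstant (Fib2 hX) ℤ) (hg : ∀ i, IsCocycle hX (g i))
    (h : Fin (n + 1) → LocallyConstant (FibProd hX hY × N) ℤ)
    (hfgh : ∀ (i : Fin (n + 1)) (x₁ x₂ : X) (y₁ y₂ : Y) (ν : N) (h₁ : πX x₁ = πY y₁)
      (h₂ : πX x₂ = πY y₂) (hx : πX x₁ = πX x₂) (hy : πY y₁ = πY y₂),
      f i (Fib2.mk hY y₁ y₂ hy) - g i (Fib2.mk hX x₁ x₂ hx) =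
        h i (FibProd.mk hX hY x₂ y₂ h₂, ν) - h i (FibProd.mk hX hY x₁ y₁ h₁, ν)) :
    (BundleGerbe.redProdFin n fun i => cupProductGerbe (K i) (f i) (hf i)).StablyIsomorphic
      (BundleGerbe.redProdFin n fun i => cupProductGerbe (K i) (g i) (hg i)) ∧
    ((BundleGerbe.redProdFin n fun i => cupProductGerbe (K i) (g i) (hg i)).dual.product
      (BundleGerbe.redProdFin n fun i => cupProductGerbe (K i) (f i) (hf i))).IsTrivialisedBy
      ((HermitianLineBundle.tensorFin n fun i =>
          ((K i).pullback (Prod.snd : FibProd hX hY × N → N) contMDiff_snd).pow (h i)).pullback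
        (FibProd.distrib N IN hX hY) (FibProd.contMDiff_distrib N IN hX hY)) := by
  constructor
  · -- Apply the second claim with the roles of `X` and `Y` exchanged: the power is `-h`.
    let h' (i : Fin (n + 1)) : LocallyConstant (FibProd hY hX × N) ℤ :=
      -(h i).comap ⟨fun p => (FibProd.swap p.1, p.2),
        (FibProd.continuous_swap.comp continuous_fst).prodMk continuous_snd⟩
    refine ⟨_, BundleGerbe.IsTrivialisedBy.dual_product_redProdFin n fun i =>
      cupProductGerbe_dual_product_isTrivialisedBy (K i) (hg i) (hf i) (h := h' i) ?_⟩
    intro y₁ y₂ x₁ x₂ ν h₁ h₂ hy hx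
    have key := hfgh i x₁ x₂ y₁ y₂ ν h₁.symm h₂.symm hx hy
    change _ = -h i (FibProd.mk hX hY x₂ y₂ h₂.symm, ν) - -h i (FibProd.mk hX hY x₁ y₁ h₁.symm, ν)
    omega
  · rw [HermitianLineBundle.pullback_tensorFin]
    exact BundleGerbe.IsTrivialisedBy.dual_product_redProdFin n fun i =>
      cupProductGerbe_dual_product_isTrivialisedBy (K i) (hf i) (hg i) (hfgh i)
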